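/- **Definitions.** Let $r,s$ be non-negative integers. The *generalised commutators* in letters $x_1,\dots,x_r$ are the formal expressions defined recursively as follows: each $x_i$ is a generalised commutator, and if $\alpha,\beta$ are generalised commutators then so is $[\alpha^{\epsilon},\beta^{\delta}]$ for all $\epsilon,\delta\in\{1,-1\}$. The weight vector $\chi(\alpha)\in\mathbb{N}_0^r$ is defined by $\chi(x_i)=e_i$ and $\chi([\alpha^{\epsilon},\beta^{\delta}])=\chi(\alpha)+\chi(\beta)$; the total weight of $\alpha$ is $|\chi(\alpha)|=\sum_i\chi(\alpha)_i$. Fix a total ordering $\prec$ of the generalised commutators, arbitrary subject to the conditions that $x_1\prec\cdots\prec x_r$; that generalised commutators of lower total weight come before those of higher total weight; that generalised commutators with the same weight vector are consecutive; and that, for any given $\alpha,\beta$, the four generalised commutators $[\alpha^{\pm1},\beta^{\pm1}]$ are consecutive. Let $\xi_1\prec\cdots\prec\xi_t$ be the finite list of all generalised commutators of total weight at most $s$. If $x_1,\dots,x_r$ are elements of an $s$-step nilpotent group $G$ (a nilpotent group of class at most $s$), each generalised commutator is interpreted as an element of $G$ via $[u,v]=u^{-1}v^{-1}uv$. For a vector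 $L=(L_1,\dots,L_r)$ of non-negative integers, write $L^{\chi}=L_1^{\chi_1}\cdots L_r^{\chi_r}$. The *nilcomplete progression* of rank $r$ and step $s$ is $$\overline P(x_1,\dots,x_r;L)=\{\xi_1^{l_1}\xi_2^{l_2}\cdots\xi_t^{l_t}\;:\;l_i\in\mathbb{Z},\ |l_i|\le L^{\chi(\xi_i)}\}.$$ For subsets $A,B\subset G$ write $AB=\{ab:a\in A,\ b\in B\}$ and $A^m$ for the set of products of $m$ elements of $A$, with $A^0=\{1\}$. **Proposition (Powers of nilcomplete progressions).** For all $r,s\ge 0$ there is a constant $C=C(r,s)\in\mathbb{N}_0$, and for every integer $M\ge 0$ there is a constant $K=K(r,s,M)\in\mathbb{N}_0$, such that the following holds. Let $G$ be an $s$-step nilpotent group, let $x_1,\dots,x_r\in G$, let $L=(L_1,\dots,L_r)$ be a vector of positive integers, and let $\prec$ be any ordering as above. Then: 1. $\overline P(x_1,\dots,x_r;nL)\subset\overline P(x_1,\dots,x_r;L)^{Cn}$ for every integer $n\ge 0$; 2. $\overline P(x_1,\dots,x_r;L)^n\subset\overline P(x_1,\dots,x_r;nL)$ for every integer $n\ge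 0$; 3. for every integer $M\ge 0$ there is a finite set $X\subset G$ with $|X|\le K(r,s,M)$ such that $\overline P(x_1,\dots,x_r;ML)\subset\overline P(x_1,\dots,x_r;L)\,X$. -/

import Mathlib

open scoped Pointwise

/-- Formal generalised commutators in the letters `x₁, …, x_r`: each letter is one, and if `a`, `b`
are generalised commutators then so is the formal expression `[a ^ ε, b ^ δ]` for all signs
`ε, δ ∈ {1, -1}` (the units of `ℤ`), written `comm ε a δ b`. -/
inductive GenComm (r : ℕ) : Type
  | letter (i : Fin r) : GenComm r
  | comm (ε : ℤˣ) (a : GenComm r) (δ : ℤˣ) (b : GenComm r) : GenComm r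

namespace GenComm

/-- The weight vector `χ` of a generalised commutator. -/
def weight {r : ℕ} : GenComm r → (Fin r → ℕ)
  | letter i => Pi.single i 1
  | comm _ a _ b => weight a + weight b

/-- The total weight `|χ|`, the sum of the entries of the weight vector. -/
def totalWeight {r : ℕ} (c : GenComm r) : ℕ := ∑ i, c.weight i

/-- The element of `G` represented by a formal generalised commutator when the letters are
replaced by `x₁, …, x_r`, with the convention `[u, v] = u⁻¹ v⁻¹ u v` (so that
`v u = u v [v, u]`). -/
def eval {G : Type*} [Group G] {r : ℕ} (x : Fin r → G) : GenComm r → G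
  | letter i => x i
  | comm ε a δ b =>
      (eval x a ^ (ε : ℤ))⁻¹ * (eval x b ^ (δ : ℤ))⁻¹ * eval x a ^ (ε : ℤ) * eval x b ^ (δ : ℤ)

theorem totalWeight_letter {r : ℕ} (i : Fin r) : (letter i).totalWeight = 1 := by
  simp [totalWeight, weight]

theorem totalWeight_comm {r : ℕ} (ε δ : ℤˣ) (a b : GenComm r) :
    (comm ε a δ b).totalWeight = a.totalWeight + b.totalWeight := by
  simp [totalWeight, weight, Finset.sum_add_distrib]

theorem one_le_totalWeight {r : ℕ} (c : GenComm r) : 1 ≤ c.totalWeight := by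
  induction c with
  | letter i => rw [totalWeight_letter]
  | comm ε a δ b iha ihb => rw [totalWeight_comm]; omega

/-- There are only finitely many generalised commutators of bounded total weight. -/
theorem finite_totalWeight_le (r s : ℕ) : {c : GenComm r | c.totalWeight ≤ s}.Finite := by
  induction s with
  | zero =>
    refine Set.Finite.subset Set.finite_empty fun c hc => ?_
    have h1 := one_le_totalWeight c
    have h2 : c.totalWeight ≤ 0 := hc
    omega
  | succ s ih =>
    have hU : (Set.univ : Set ℤˣ).Finite := Set.toFinite _
    refine Set.Finite.subset ((Set.finite_range (letter (r := r))).union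
      (((hU.prod ih).prod (hU.prod ih)).image fun p => comm p.1.1 p.1.2 p.2.1 p.2.2)) ?_
    intro c hc
    cases c with
    | letter i => exact Or.inl ⟨i, rfl⟩
    | comm ε a δ b =>
      right
      have h : (comm ε a δ b).totalWeight ≤ s + 1 := hc
      rw [totalWeight_comm] at h
      have ha := one_le_totalWeight a
      have hb := one_le_totalWeight b
      refine ⟨((ε, a), (δ, b)), ⟨⟨trivial, ?_⟩, ⟨trivial, ?_⟩⟩, rfl⟩
      · change a.totalWeight ≤ s; omega
      · change b.totalWeight ≤ s; omega

/-- The finite set of generalised commutators of total weight at most `s`. -/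
noncomputable def upTo (r s : ℕ) : Finset (GenComm r) := (finite_totalWeight_le r s).toFinset

/-- The conditions imposed on the otherwise arbitrary total ordering `≺` of the generalised
commutators. -/
structure IsAdmissible {r : ℕ} (ord : LinearOrder (GenComm r)) : Prop where
  /-- `x₁ ≺ … ≺ x_r`. -/
  letter_lt : ∀ i j : Fin r, i < j → ord.lt (letter i) (letter j)
  /-- Lower total weight comes before higher total weight. -/
  lt_of_totalWeight_lt : ∀ a b : GenComm r, a.totalWeight < b.totalWeight → ord.lt a b
  /-- Generalised commutators of the same weight vector are consecutive. -/
  weight_consecutive : ∀ a b c : GenComm r, ord.lt a b → ord.lt b c → a.weight = c.weight →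
    b.weight = a.weight
  /-- For given `a` and `b` the expressions `[a ^ ±1, b ^ ±1]` are consecutive. -/
  sign_consecutive : ∀ (a b : GenComm r) (ε δ ε' δ' : ℤˣ) (c : GenComm r),
    ord.lt (comm ε a δ b) c → ord.lt c (comm ε' a δ' b) → ∃ ε'' δ'' : ℤˣ, c = comm ε'' a δ'' b

/-- The list `ξ₁, …, ξ_t` of all generalised commutators of total weight at most `s`, in
increasing order with respect to `ord`. -/
noncomputable def orderedList {r : ℕ} (ord : LinearOrder (GenComm r)) (s : ℕ) :
    List (GenComm r) :=
  letI := ord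
  (upTo r s).sort

end GenComm

/-- `L ^ χ = L₁ ^ χ₁ ⋯ L_r ^ χ_r`. -/
def vecPow {r : ℕ} (L χ : Fin r → ℕ) : ℕ := ∏ i, L i ^ χ i

/-- The nilcomplete progression
`P̄(x₁, …, x_r; L) = {ξ₁ ^ l₁ ⋯ ξ_t ^ l_t : |l_i| ≤ L ^ χ(ξ_i)}` of step `s`, formed with the
ordering `ord`. -/
def nilcompleteProgression {G : Type*} [Group G] {r : ℕ} (ord : LinearOrder (GenComm r)) (s : ℕ)
    (x : Fin r → G) (L : Fin r → ℕ) : Set G :=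
  {g | ∃ l : GenComm r → ℤ,
    (∀ ξ ∈ GenComm.orderedList ord s, |l ξ| ≤ (vecPow L ξ.weight : ℤ)) ∧
    g = ((GenComm.orderedList ord s).map fun ξ => GenComm.eval x ξ ^ l ξ).prod}

/-!
All three parts are proved by collecting words in the generalised commutators. Moving a symbol
`ξ ^ δ` to the left across `η ^ ε` costs one further symbol, the formal commutator
`[η ^ ε, ξ ^ δ]`, which is again a generalised commutator. Hence moving a word `zs` to the left
across a word `p` creates at most one `[η ^ ε, ξ ^ δ]` for each pair of an `η` in the result and a
`ξ` in `zs` (`cnt_comm_conj_le`). Say that a word is bounded by `N` if every `ξ` occurs in it at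
most `N ^ χ(ξ)` times. As `χ` is additive, moving a word bounded by `N'` across one bounded by `N`
leaves a word bounded by `N + N'` (`Bounded.conj`). Symbols of total weight more than `s` are
trivial in an `s`-step nilpotent group, so every collecting process ends.

*Products.* The second part follows from `P̄(A) P̄(B) ⊆ P̄(A + B)`. Collect `ξ₁, ξ₂, …` in turn from
the product of two ordered words. Two symbols that come from the same factor are in the right order
and are never interchanged, so that by induction the number of created copies of `ζ` is at most
`(A + B) ^ χ(ζ) - A ^ χ(ζ) - B ^ χ(ζ)` (`exists_wordProd_mul_eq`).

*Covering.* Given a word bounded by `c L`, extract `ξ₁ ^ m`, write `m = ρ + q D` with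
`D = L ^ χ(ξ₁)` and `0 ≤ ρ < D`, move `ξ₁ ^ (q D)` to the far right, and continue with `ξ₂, ξ₃, …`
on the word that remains in the middle, which is bounded by `c' L`. The elements
`⋯ ξ₂ ^ (q₂ D₂) ξ₁ ^ (q₁ D₁)` arising on the right range over a set of bounded size
(`exists_covering`).

*Dilates.* That words bounded by `n L` are products of `O(n)` elements of `P̄(L)` is proved for
words of total weight at least `d`, by downward induction on `d`. It suffices to treat `ξ ^ m` with
`ξ` of weight `d` and `|m| ≤ (n L) ^ χ(ξ)`. Substituting powers `x_i ^ k` with `k ≤ n L_i` for the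
letters of `ξ` gives an element which is a product of `O(n)` elements of `P̄(L)`, and which equals
`ξ ^ m'` times a word of higher weight bounded by `O(n) L`, where `m'` is the product of the
exponents `k` (`IsMonomial.exists_pow_mul`). A mixed radix expansion shows that `|m|` is a sum of
`d` such products `m'` (`exists_sum_isMonomial`).
-/

/-! ### Nilpotency and weights -/

/-- The lower central series satisfies `⁅γ_{m+1}, γ_{n+1}⁆ ≤ γ_{m+n+2}` (Mathlib indexes it from
`0`); this is the three subgroups lemma, applied modulo the right-hand side. -/
theorem commutator_lowerCentralSeries_le {G : Type*} [Group G] (m n : ℕ) :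
    ⁅(⊤ : Subgroup G).lowerCentralSeries m, (⊤ : Subgroup G).lowerCentralSeries n⁆ ≤
      (⊤ : Subgroup G).lowerCentralSeries (m + n + 1) := by
  induction m generalizing n with
  | zero =>
    rw [Subgroup.lowerCentralSeries_zero, Subgroup.commutator_comm, zero_add,
      Subgroup.lowerCentralSeries_succ]
  | succ m ih =>
    have hker (H : Subgroup G) : H ≤ (⊤ : Subgroup G).lowerCentralSeries (m + 1 + n + 1) ↔
        H.map (QuotientGroup.mk' ((⊤ : Subgroup G).lowerCentralSeries (m + 1 + n + 1))) = ⊥ := by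
      rw [Subgroup.map_eq_bot_iff, QuotientGroup.ker_mk']
    rw [hker, Subgroup.lowerCentralSeries_succ _ m, Subgroup.map_commutator,
      Subgroup.map_commutator]
    refine Subgroup.commutator_commutator_eq_bot_of_rotate ?_ ?_
    · rw [← Subgroup.map_commutator, ← Subgroup.map_commutator, ← hker,
        Subgroup.commutator_comm ⊤, ← Subgroup.lowerCentralSeries_succ, Subgroup.commutator_comm]
      refine (ih (n + 1)).trans (le_of_eq ?_)
      congr 1; omega
    · rw [← Subgroup.map_commutator, ← Subgroup.map_commutator, ← hker]
      have h := Subgroup.commutator_mono (ih n) (le_refl (⊤ : Subgroup G))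
      rw [← Subgroup.lowerCentralSeries_succ] at h
      rw [Subgroup.commutator_comm ((⊤ : Subgroup G).lowerCentralSeries n)]
      refine h.trans (le_of_eq ?_)
      congr 1; omega

namespace GenComm

variable {G : Type*} [Group G] {r : ℕ}

theorem eval_mem_lowerCentralSeries (x : Fin r → G) (c : GenComm r) :
    c.eval x ∈ (⊤ : Subgroup G).lowerCentralSeries (c.totalWeight - 1) := by
  induction c with
  | letter i => simp [totalWeight_letter]
  | comm ε a δ b iha ihb =>
    have h := commutator_lowerCentralSeries_le _ _ (Subgroup.commutator_mem_commutator
      (inv_mem (zpow_mem iha (ε : ℤ))) (inv_mem (zpow_mem ihb (δ : ℤ))))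
    have ha := one_le_totalWeight a
    have hb := one_le_totalWeight b
    have hw : (comm ε a δ b).totalWeight - 1 = a.totalWeight - 1 + (b.totalWeight - 1) + 1 := by
      rw [totalWeight_comm]; omega
    rw [hw]
    simpa [commutatorElement_def, eval] using h

theorem eval_eq_one_of_nilpotencyClass_lt [Group.IsNilpotent G] (x : Fin r → G) {c : GenComm r}
    (h : Group.nilpotencyClass G < c.totalWeight) : c.eval x = 1 := by
  have h1 := eval_mem_lowerCentralSeries x c
  have h2 : (⊤ : Subgroup G).lowerCentralSeries (c.totalWeight - 1) = ⊥ :=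
    Subgroup.lowerCentralSeries_eq_bot_iff_nilpotencyClass_le.2 (by omega)
  rwa [h2, Subgroup.mem_bot] at h1

theorem mem_orderedList {ord : LinearOrder (GenComm r)} {s : ℕ} {c : GenComm r} :
    c ∈ orderedList ord s ↔ c.totalWeight ≤ s := by
  simp [orderedList, upTo]

theorem nodup_orderedList (ord : LinearOrder (GenComm r)) (s : ℕ) :
    (orderedList ord s).Nodup := by
  simp [orderedList]

theorem length_orderedList (ord : LinearOrder (GenComm r)) (s : ℕ) :
    (orderedList ord s).length = (upTo r s).card := by
  simp [orderedList]

theorem pairwise_orderedList {ord : LinearOrder (GenComm r)} (h : IsAdmissible ord) (s : ℕ) :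
    (orderedList ord s).Pairwise fun a b => a.totalWeight ≤ b.totalWeight := by
  let := ord
  refine List.Pairwise.imp (fun {a b} hab => ?_) (Finset.pairwise_sort (upTo r s) (· ≤ ·))
  by_contra hlt
  exact absurd (h.lt_of_totalWeight_lt b a (not_le.1 hlt)) (not_lt.2 hab)

end GenComm

section vecPow

variable {r : ℕ}

theorem vecPow_add (L χ χ' : Fin r → ℕ) : vecPow L (χ + χ') = vecPow L χ * vecPow L χ' := by
  simp [vecPow, pow_add, Finset.prod_mul_distrib]

theorem vecPow_letter (L : Fin r → ℕ) (i : Fin r) :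
    vecPow L (GenComm.letter i).weight = L i := by
  classical
  rw [vecPow, Finset.prod_eq_single i]
  · simp [GenComm.weight]
  · intro j _ hj
    simp [GenComm.weight, Pi.single_eq_of_ne hj]
  · simp

theorem vecPow_comm (L : Fin r → ℕ) (ε δ : ℤˣ) (a b : GenComm r) :
    vecPow L (GenComm.comm ε a δ b).weight = vecPow L a.weight * vecPow L b.weight :=
  vecPow_add _ _ _

theorem vecPow_mono {L L' : Fin r → ℕ} (h : L ≤ L') (χ : Fin r → ℕ) :
    vecPow L χ ≤ vecPow L' χ :=
  Finset.prod_le_prod' fun i _ => Nat.pow_le_pow_left (h i) _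

theorem vecPow_pos {L : Fin r → ℕ} (h : ∀ i, 0 < L i) (χ : Fin r → ℕ) : 0 < vecPow L χ :=
  Finset.prod_pos fun i _ => pow_pos (h i) _

theorem vecPow_nsmul (c : ℕ) (L : Fin r → ℕ) (ξ : GenComm r) :
    vecPow (c • L) ξ.weight = c ^ ξ.totalWeight * vecPow L ξ.weight := by
  simp [vecPow, mul_pow, Finset.prod_mul_distrib, GenComm.totalWeight, Finset.prod_pow_eq_pow_sum]

/-- Superadditivity of `L ↦ L ^ χ`; it fails for the zero weight vector. -/
theorem vecPow_add_le (A B : Fin r → ℕ) (ξ : GenComm r) :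
    vecPow A ξ.weight + vecPow B ξ.weight ≤ vecPow (A + B) ξ.weight := by
  induction ξ with
  | letter i => simp [vecPow_letter]
  | comm ε a δ b iha ihb =>
    simp only [vecPow_comm]
    calc _ ≤ (vecPow A a.weight + vecPow B a.weight) * (vecPow A b.weight + vecPow B b.weight) := by
          rw [add_mul, mul_add, mul_add]; omega
      _ ≤ _ := Nat.mul_le_mul iha ihb

end vecPow

/-! ### Words in the generalised commutators -/

namespace GenComm

section Words

open scoped Classical

variable {G : Type*} [Group G] {r : ℕ}

/-- A symbol `ξ ^ ε` with `ξ` a generalised commutator and `ε = ±1`. Words are lists of symbols. -/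
abbrev Symbol (r : ℕ) : Type := GenComm r × ℤˣ

/-- The formal commutator of two symbols; it is again a generalised commutator. -/
def bracket (y z : Symbol r) : Symbol r := (comm y.2 y.1 z.2 z.1, 1)

/-- The element of `G` represented by a symbol. -/
def val (x : Fin r → G) (y : Symbol r) : G := y.1.eval x ^ (y.2 : ℤ)

/-- The element of `G` represented by a word. -/
def wordProd (x : Fin r → G) (p : List (Symbol r)) : G := (p.map (val x)).prod

@[simp] theorem wordProd_nil (x : Fin r → G) : wordProd x [] = 1 := rfl

@[simp] theorem wordProd_cons (x : Fin r → G) (y : Symbol r) (p : List (Symbol r)) :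
    wordProd x (y :: p) = val x y * wordProd x p := by simp [wordProd]

@[simp] theorem wordProd_append (x : Fin r → G) (p q : List (Symbol r)) :
    wordProd x (p ++ q) = wordProd x p * wordProd x q := by simp [wordProd]

theorem val_bracket (x : Fin r → G) (y z : Symbol r) :
    val x (bracket y z) = (val x y)⁻¹ * (val x z)⁻¹ * val x y * val x z := by
  simp [val, bracket, eval]

theorem totalWeight_bracket (y z : Symbol r) :
    (bracket y z).1.totalWeight = y.1.totalWeight + z.1.totalWeight := totalWeight_comm _ _ _ _

/-- The word obtained from `p` when the symbol `z` is moved from its right to its left, through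
`y z = z y [y, z]`: it represents the conjugate `z⁻¹ p z`. -/
def pass (z : Symbol r) (p : List (Symbol r)) : List (Symbol r) :=
  p.flatMap fun y => [y, bracket y z]

/-- The word obtained from `p` when the word `zs` is moved, symbol by symbol, from its right to
its left: it represents `zs⁻¹ p zs`. -/
def conj : List (Symbol r) → List (Symbol r) → List (Symbol r)
  | [], p => p
  | z :: zs, p => conj zs (pass z p)

@[simp] theorem pass_nil (z : Symbol r) : pass z [] = [] := rfl

@[simp] theorem pass_cons (z y : Symbol r) (p : List (Symbol r)) :
    pass z (y :: p) = y :: bracket y z :: pass z p := rfl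

@[simp] theorem pass_append (z : Symbol r) (p q : List (Symbol r)) :
    pass z (p ++ q) = pass z p ++ pass z q := by simp [pass]

@[simp] theorem conj_nil_left (p : List (Symbol r)) : conj [] p = p := rfl

@[simp] theorem conj_cons (z : Symbol r) (zs p : List (Symbol r)) :
    conj (z :: zs) p = conj zs (pass z p) := rfl

theorem conj_append (zs p q : List (Symbol r)) : conj zs (p ++ q) = conj zs p ++ conj zs q := by
  induction zs generalizing p q with
  | nil => rfl
  | cons z zs ih => simp [ih]

theorem conj_cons_right (zs : List (Symbol r)) (y : Symbol r) (p : List (Symbol r)) :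
    conj zs (y :: p) = conj zs [y] ++ conj zs p := conj_append zs [y] p

theorem wordProd_pass (x : Fin r → G) (z : Symbol r) (p : List (Symbol r)) :
    wordProd x (pass z p) = (val x z)⁻¹ * wordProd x p * val x z := by
  induction p with
  | nil => simp
  | cons y p ih => simp [ih, val_bracket]; group

theorem wordProd_conj (x : Fin r → G) (zs p : List (Symbol r)) :
    wordProd x (conj zs p) = (wordProd x zs)⁻¹ * wordProd x p * wordProd x zs := by
  induction zs generalizing p with
  | nil => simp
  | cons z zs ih => simp [ih, wordProd_pass]; group

theorem sublist_pass (z : Symbol r) (p : List (Symbol r)) : p.Sublist (pass z p) := by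
  induction p with
  | nil => simp
  | cons y p ih => exact (ih.cons _).cons_cons _

theorem pass_sublist_pass (z : Symbol r) {p q : List (Symbol r)} (h : p.Sublist q) :
    (pass z p).Sublist (pass z q) := by
  induction h with
  | slnil => simp
  | cons y _ ih => exact (ih.cons _).cons _
  | cons_cons y _ ih => exact (ih.cons_cons _).cons_cons _

theorem conj_sublist_conj_right (zs : List (Symbol r)) {p q : List (Symbol r)}
    (h : p.Sublist q) : (conj zs p).Sublist (conj zs q) := by
  induction zs generalizing p q with
  | nil => exact h
  | cons z zs ih => exact ih (pass_sublist_pass z h)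

theorem sublist_conj (zs p : List (Symbol r)) : p.Sublist (conj zs p) := by
  induction zs generalizing p with
  | nil => exact List.Sublist.refl p
  | cons z zs ih => exact (sublist_pass z p).trans (ih _)

theorem conj_sublist_conj_left {zs zs' : List (Symbol r)} (h : zs.Sublist zs')
    (p : List (Symbol r)) : (conj zs p).Sublist (conj zs' p) := by
  induction h generalizing p with
  | slnil => exact List.Sublist.refl _
  | cons z _ ih => exact (ih p).trans (conj_sublist_conj_right _ (sublist_pass z p))
  | cons_cons z _ ih => exact ih _

/-- Symbols created by moving `zs` across `p` have weight at least the sum of the smallest weights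
of `p` and `zs`. -/
theorem mem_conj {zs p : List (Symbol r)} {d e : ℕ} (hp : ∀ y ∈ p, d ≤ y.1.totalWeight)
    (hzs : ∀ z ∈ zs, e ≤ z.1.totalWeight) {y : Symbol r} (hy : y ∈ conj zs p) :
    y ∈ p ∨ d + e ≤ y.1.totalWeight := by
  induction zs generalizing p with
  | nil => exact Or.inl hy
  | cons z zs ih =>
    have hz := hzs z (by simp)
    have hpass : ∀ y ∈ pass z p, y ∈ p ∨ d + e ≤ y.1.totalWeight := by
      intro y hy
      simp only [pass, List.mem_flatMap, List.mem_cons, List.not_mem_nil, or_false] at hy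
      obtain ⟨u, hu, rfl | rfl⟩ := hy
      · exact Or.inl hu
      · have := hp u hu
        rw [totalWeight_bracket]
        omega
    rcases ih (p := pass z p) (fun y hy => (hpass y hy).elim (hp y) (by omega))
      (fun z hz => hzs z (by simp [hz])) hy with h | h
    · exact hpass y h
    · exact Or.inr h

/-- The number of occurrences of `ξ` and `ξ⁻¹` in a word. -/
noncomputable def cnt (ξ : GenComm r) (p : List (Symbol r)) : ℕ := p.countP fun y => y.1 = ξ

@[simp] theorem cnt_nil (ξ : GenComm r) : cnt ξ [] = 0 := rfl

theorem cnt_cons (ξ : GenComm r) (y : Symbol r) (p : List (Symbol r)) :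
    cnt ξ (y :: p) = cnt ξ p + if y.1 = ξ then 1 else 0 := by
  simp [cnt, List.countP_cons]

@[simp] theorem cnt_append (ξ : GenComm r) (p q : List (Symbol r)) :
    cnt ξ (p ++ q) = cnt ξ p + cnt ξ q := by simp [cnt]

theorem cnt_le_of_sublist (ξ : GenComm r) {p q : List (Symbol r)} (h : p.Sublist q) :
    cnt ξ p ≤ cnt ξ q := h.countP_le

theorem cnt_eq_zero {ξ : GenComm r} {p : List (Symbol r)} :
    cnt ξ p = 0 ↔ ∀ y ∈ p, y.1 ≠ ξ := by
  simp [cnt, List.countP_eq_zero]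

theorem cnt_replicate (ξ : GenComm r) (n : ℕ) (y : Symbol r) :
    cnt ξ (List.replicate n y) = if y.1 = ξ then n else 0 := by
  simp [cnt, List.countP_replicate]

theorem cnt_letter_pass (i : Fin r) (z : Symbol r) (p : List (Symbol r)) :
    cnt (letter i) (pass z p) = cnt (letter i) p := by
  induction p with
  | nil => rfl
  | cons y p ih => simp [cnt_cons, ih, bracket]

theorem cnt_letter_conj (i : Fin r) (zs p : List (Symbol r)) :
    cnt (letter i) (conj zs p) = cnt (letter i) p := by
  induction zs generalizing p with
  | nil => rfl
  | cons z zs ih => simp [ih, cnt_letter_pass]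

theorem cnt_comm_pass_le (ε δ : ℤˣ) (η ξ : GenComm r) (z : Symbol r) (p : List (Symbol r)) :
    cnt (comm ε η δ ξ) (pass z p) ≤
      cnt (comm ε η δ ξ) p + cnt η p * if z.1 = ξ then 1 else 0 := by
  induction p with
  | nil => simp
  | cons y p ih =>
    simp only [pass_cons, cnt_cons, bracket, comm.injEq]
    split_ifs at * <;> first | omega | tauto

/-- Moving `zs` to the left across `p` creates at most one copy of `[η ^ ε, ξ ^ δ]` for each pair
of an occurrence of `η` in the resulting word and an occurrence of `ξ` in `zs`. -/
theorem cnt_comm_conj_le (ε δ : ℤˣ) (η ξ : GenComm r) (zs p : List (Symbol r)) :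
    cnt (comm ε η δ ξ) (conj zs p) ≤
      cnt (comm ε η δ ξ) p + cnt η (conj zs p) * cnt ξ zs := by
  induction zs generalizing p with
  | nil => simp
  | cons z zs ih =>
    have h1 := ih (pass z p)
    have h2 := cnt_comm_pass_le ε δ η ξ z p
    have h3 : cnt η p ≤ cnt η (conj (z :: zs) p) := cnt_le_of_sublist η (sublist_conj _ _)
    rw [conj_cons] at h3 ⊢
    rw [cnt_cons, mul_add]
    have h4 := Nat.mul_le_mul_right (if z.1 = ξ then 1 else 0) h3
    omega

/-- `Bounded N p` says that each generalised commutator `ξ` occurs, with either sign, at most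
`N ^ χ(ξ)` times in the word `p`. -/
def Bounded (N : Fin r → ℕ) (p : List (Symbol r)) : Prop :=
  ∀ ξ : GenComm r, cnt ξ p ≤ vecPow N ξ.weight

theorem Bounded.sublist {N : Fin r → ℕ} {p q : List (Symbol r)} (hq : Bounded N q)
    (h : p.Sublist q) : Bounded N p :=
  fun ξ => (cnt_le_of_sublist ξ h).trans (hq ξ)

/-- The basic estimate: the bounds of `zs` and `p` add up when `zs` is moved across `p`. By
induction on `ζ = [η ^ ε, ξ ^ δ]`, the number of `ζ`'s is at most
`N ^ χ(η) N ^ χ(ξ) + (N + N') ^ χ(η) N' ^ χ(ξ) ≤ (N + N') ^ χ(ζ)`. -/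
theorem Bounded.conj {N N' : Fin r → ℕ} {zs p : List (Symbol r)} (hp : Bounded N p)
    (hzs : Bounded N' zs) : Bounded (N + N') (conj zs p) := by
  intro ζ
  induction ζ with
  | letter i =>
    rw [cnt_letter_conj]
    exact (hp _).trans (vecPow_mono le_self_add _)
  | comm ε η δ ξ ihη _ =>
    refine (cnt_comm_conj_le ε δ η ξ zs p).trans ?_
    have h1 := hp (comm ε η δ ξ)
    rw [vecPow_comm] at h1 ⊢
    calc _ ≤ vecPow (N + N') η.weight * vecPow N ξ.weight +
          vecPow (N + N') η.weight * vecPow N' ξ.weight :=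
          add_le_add (h1.trans (Nat.mul_le_mul_right _ (vecPow_mono le_self_add _)))
            (Nat.mul_le_mul ihη (hzs ξ))
      _ ≤ _ := by
          rw [← mul_add]
          exact Nat.mul_le_mul_left _ (vecPow_add_le N N' ξ)

/-- The word of the power `ξ ^ m`. -/
def powWord (ξ : GenComm r) (m : ℤ) : List (Symbol r) :=
  List.replicate m.natAbs (ξ, if 0 ≤ m then 1 else -1)

theorem wordProd_replicate (x : Fin r → G) (n : ℕ) (y : Symbol r) :
    wordProd x (List.replicate n y) = val x y ^ n := by
  simp [wordProd]

@[simp] theorem wordProd_powWord (x : Fin r → G) (ξ : GenComm r) (m : ℤ) :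
    wordProd x (powWord ξ m) = ξ.eval x ^ m := by
  rw [powWord, wordProd_replicate, val, ← zpow_natCast, ← zpow_mul]
  congr 1
  split_ifs with h
  · simp [h]
  · push Not at h
    simp [abs_of_neg h]

theorem cnt_powWord (ζ ξ : GenComm r) (m : ℤ) :
    cnt ζ (powWord ξ m) = if ξ = ζ then m.natAbs else 0 := by
  simp [powWord, cnt_replicate]

theorem bounded_powWord {N : Fin r → ℕ} {ξ : GenComm r} {m : ℤ}
    (h : |m| ≤ (vecPow N ξ.weight : ℤ)) : Bounded N (powWord ξ m) := by
  intro ζ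
  rw [cnt_powWord]
  split_ifs with hζ
  · subst hζ
    rw [Int.abs_eq_natAbs] at h
    exact_mod_cast h
  · exact Nat.zero_le _

/-- The word of the ordered product `∏ ξ ^ a_ξ` over the list `l`. -/
def listWord (a : GenComm r → ℤ) (l : List (GenComm r)) : List (Symbol r) :=
  l.flatMap fun ξ => powWord ξ (a ξ)

@[simp] theorem listWord_cons (a : GenComm r → ℤ) (ξ : GenComm r) (l : List (GenComm r)) :
    listWord a (ξ :: l) = powWord ξ (a ξ) ++ listWord a l := rfl

theorem wordProd_listWord (x : Fin r → G) (a : GenComm r → ℤ) (l : List (GenComm r)) :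
    wordProd x (listWord a l) = (l.map fun ξ => ξ.eval x ^ a ξ).prod := by
  induction l with
  | nil => rfl
  | cons ξ l ih => simp [ih]

theorem cnt_listWord {a : GenComm r → ℤ} {l : List (GenComm r)} (hl : l.Nodup) (ζ : GenComm r) :
    cnt ζ (listWord a l) = if ζ ∈ l then (a ζ).natAbs else 0 := by
  induction l with
  | nil => rfl
  | cons ξ l ih =>
    rw [List.nodup_cons] at hl
    rw [listWord_cons, cnt_append, cnt_powWord, ih hl.2]
    by_cases h : ξ = ζ
    · subst h
      simp [hl.1]
    · simp [h, Ne.symm h]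

theorem bounded_listWord {N : Fin r → ℕ} {a : GenComm r → ℤ} {l : List (GenComm r)}
    (hl : l.Nodup) (h : ∀ ξ ∈ l, |a ξ| ≤ (vecPow N ξ.weight : ℤ)) :
    Bounded N (listWord a l) := by
  intro ζ
  rw [cnt_listWord hl]
  split_ifs with hζ
  · have := h ζ hζ
    rw [Int.abs_eq_natAbs] at this
    exact_mod_cast this
  · exact Nat.zero_le _

/-! ### Moving one generalised commutator to the front -/

/-- The occurrences of `ξ` in a word, as a word. -/
noncomputable def occ (ξ : GenComm r) (p : List (Symbol r)) : List (Symbol r) :=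
  p.filter fun y => y.1 = ξ

/-- What remains to the right when all occurrences of `ξ` in the word are moved, one at a time, to
its front. -/
noncomputable def extract (ξ : GenComm r) : List (Symbol r) → List (Symbol r)
  | [] => []
  | y :: p => if y.1 = ξ then extract ξ p else conj (occ ξ p) [y] ++ extract ξ p

theorem occ_cons (ξ : GenComm r) (y : Symbol r) (p : List (Symbol r)) :
    occ ξ (y :: p) = if y.1 = ξ then y :: occ ξ p else occ ξ p := by
  simp [occ, List.filter_cons]

theorem extract_cons (ξ : GenComm r) (y : Symbol r) (p : List (Symbol r)) :
    extract ξ (y :: p) = if y.1 = ξ then extract ξ p else conj (occ ξ p) [y] ++ extract ξ p := rfl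

theorem mem_occ {ξ : GenComm r} {p : List (Symbol r)} {y : Symbol r} :
    y ∈ occ ξ p ↔ y ∈ p ∧ y.1 = ξ := by simp [occ]

theorem occ_sublist (ξ : GenComm r) (p : List (Symbol r)) : (occ ξ p).Sublist p :=
  List.filter_sublist

theorem cnt_occ (ζ ξ : GenComm r) (p : List (Symbol r)) :
    cnt ζ (occ ξ p) = if ξ = ζ then cnt ξ p else 0 := by
  induction p with
  | nil => simp [occ]
  | cons y p ih =>
    rw [occ_cons, cnt_cons]
    by_cases h : y.1 = ξ
    · rw [if_pos h, cnt_cons, ih, h]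
      split_ifs <;> simp_all
    · simp [h, ih]

theorem wordProd_extract (x : Fin r → G) (ξ : GenComm r) (p : List (Symbol r)) :
    wordProd x p = wordProd x (occ ξ p) * wordProd x (extract ξ p) := by
  induction p with
  | nil => simp [occ, extract]
  | cons y p ih =>
    rw [occ_cons, extract_cons, wordProd_cons, ih]
    split_ifs with h
    · rw [wordProd_cons, mul_assoc]
    · rw [wordProd_append, wordProd_conj]
      simp [mul_assoc]

theorem exists_wordProd_occ (x : Fin r → G) (ξ : GenComm r) (p : List (Symbol r)) :
    ∃ m : ℤ, |m| ≤ cnt ξ p ∧ wordProd x (occ ξ p) = ξ.eval x ^ m := by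
  induction p with
  | nil => exact ⟨0, by simp, by simp [occ]⟩
  | cons y p ih =>
    obtain ⟨m, hm, he⟩ := ih
    rw [occ_cons, cnt_cons]
    split_ifs with h
    · refine ⟨y.2 + m, ?_, ?_⟩
      · rcases Int.units_eq_one_or y.2 with hy | hy <;> simp only [hy] <;> push_cast <;>
          rw [abs_le] at * <;> constructor <;> omega
      · rw [wordProd_cons, he, val, h, zpow_add]
    · exact ⟨m, by simpa using hm, he⟩

theorem extract_sublist (ξ : GenComm r) (p : List (Symbol r)) :
    (extract ξ p).Sublist (conj (occ ξ p) p) := by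
  induction p with
  | nil => simp [extract]
  | cons y p ih =>
    rw [extract_cons, occ_cons]
    split_ifs with h
    · rw [conj_cons_right]
      exact (ih.trans (conj_sublist_conj_left (List.sublist_cons_self y _) p)).trans
        (List.sublist_append_right _ _)
    · rw [conj_cons_right (occ ξ p) y p]
      exact (List.Sublist.refl _).append ih

theorem Bounded.extract {N : Fin r → ℕ} {p : List (Symbol r)} (h : Bounded N p) (ξ : GenComm r) :
    Bounded (2 • N) (extract ξ p) := by
  rw [two_nsmul]
  exact (h.conj (h.sublist (occ_sublist ξ p))).sublist (extract_sublist ξ p)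

theorem filter_sublist_extract (ξ : GenComm r) (p : List (Symbol r)) :
    (p.filter fun y => y.1 ≠ ξ).Sublist (extract ξ p) := by
  induction p with
  | nil => simp [extract]
  | cons y p ih =>
    rw [extract_cons, List.filter_cons]
    by_cases h : y.1 = ξ
    · simpa [h] using ih
    · simpa [h] using (sublist_conj (occ ξ p) [y]).append ih

theorem mem_extract {ξ : GenComm r} {p : List (Symbol r)} {d : ℕ}
    (hp : ∀ y ∈ p, d ≤ y.1.totalWeight) {y : Symbol r} (hy : y ∈ GenComm.extract ξ p) :
    (y ∈ p ∧ y.1 ≠ ξ) ∨ d + ξ.totalWeight ≤ y.1.totalWeight := by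
  induction p with
  | nil => simp [GenComm.extract] at hy
  | cons u p ih =>
    have hp' : ∀ y ∈ p, d ≤ y.1.totalWeight := fun y hy => hp y (by simp [hy])
    have key : y ∈ GenComm.extract ξ p →
        (y ∈ u :: p ∧ y.1 ≠ ξ) ∨ d + ξ.totalWeight ≤ y.1.totalWeight := fun h =>
      (ih hp' h).imp_left fun h => ⟨by simp [h.1], h.2⟩
    rw [extract_cons] at hy
    split_ifs at hy with h
    · exact key hy
    · rcases List.mem_append.1 hy with hy | hy
      · refine (mem_conj (d := d) (e := ξ.totalWeight) (p := [u]) ?_ ?_ hy).imp_left fun h' => ?_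
        · intro v hv
          exact hp v (by simp_all)
        · intro z hz
          rw [(mem_occ.1 hz).2]
        · rw [List.mem_singleton] at h'
          subst h'
          exact ⟨by simp, h⟩
      · exact key hy

theorem cnt_letter_extract_le (i : Fin r) (ξ : GenComm r) (p : List (Symbol r)) :
    cnt (letter i) (extract ξ p) ≤ cnt (letter i) p := by
  refine (cnt_le_of_sublist _ (extract_sublist ξ p)).trans ?_
  rw [cnt_letter_conj]

theorem cnt_comm_extract_le (ε δ : ℤˣ) (η ξ' ξ : GenComm r) (p : List (Symbol r)) :
    cnt (comm ε η δ ξ') (extract ξ p) ≤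
      cnt (comm ε η δ ξ') p + cnt η (extract ξ p) * cnt ξ' (occ ξ p) := by
  induction p with
  | nil => simp [extract]
  | cons y p ih =>
    by_cases h : y.1 = ξ
    · rw [extract_cons, occ_cons, if_pos h, if_pos h, cnt_cons, cnt_cons, mul_add]
      omega
    · rw [extract_cons, occ_cons, if_neg h, if_neg h, cnt_append, cnt_append, cnt_cons, add_mul]
      have := cnt_comm_conj_le ε δ η ξ' (occ ξ p) [y]
      rw [cnt_cons, cnt_nil] at this
      omega

end Words

end GenComm

/-! ### Products of two progressions -/

namespace GenComm

section Words

open scoped Classical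

variable {G : Type*} [Group G] {r : ℕ}

/-- The arithmetic behind `exists_wordProd_mul_eq`. Here `e₁ + e₂` and `p₁ + p₂` are the numbers of
`η`'s and `ξ`'s, `a` and `a'` of which belong to the first factor, and the product
`a * a'` of pairs that are already in order is not counted on the left. -/
theorem collecting_inequality {e₁ e₂ p₁ p₂ k a a' Aη Bη Tη Aξ Bξ Tξ : ℕ}
    (hη : e₁ + e₂ + Aη + Bη ≤ Tη + a') (hξ : p₁ + p₂ + Aξ + Bξ ≤ Tξ + a) (he : a' ≤ e₂)
    (hp : a ≤ p₁) (ha' : a' ≤ Aη) (ha : a ≤ Aξ) (hk : k ≤ Bξ) :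
    e₁ * (p₁ + p₂ + k) + e₂ * (p₂ + k) + Aη * Aξ + Bη * Bξ ≤ Tη * Tξ := by
  obtain ⟨e, rfl⟩ := Nat.exists_eq_add_of_le he
  have h1 : e₁ * (p₁ + p₂ + k) ≤ e₁ * Tξ := Nat.mul_le_mul_left _ (by omega)
  have h2 : e * (p₂ + k) ≤ e * Tξ := Nat.mul_le_mul_left _ (by omega)
  have h3 : a' * (p₂ + k) ≤ Aη * (p₂ + k) := Nat.mul_le_mul_right _ ha'
  have h4 : Aη * (p₂ + k + Aξ) ≤ Aη * Tξ := Nat.mul_le_mul_left _ (by omega)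
  have h5 : Bη * Bξ ≤ Bη * Tξ := Nat.mul_le_mul_left _ (by omega)
  have h6 : (e₁ + e + Aη + Bη) * Tξ ≤ Tη * Tξ := Nat.mul_le_mul_right _ (by omega)
  simp only [add_mul, mul_add] at *
  omega

/-- The collecting process for the product of two ordered words. The word `w` holds what is left of
the first factor (the subword `listWord a l`) and the commutators created so far, `b` is what is
left of the second factor, and the generalised commutators in `pre` have been collected.
The hypothesis `hcnt` bounds the number of created copies of `ζ` by
`(A + B) ^ χ(ζ) - A ^ χ(ζ) - B ^ χ(ζ)`. It survives the collection of `ξ`, which creates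
`[η ^ ε, ξ ^ δ]` at most once for each pair consisting of an `η` and a `ξ`, because two symbols of
the same factor never have to be interchanged. -/
theorem exists_wordProd_mul_eq (x : Fin r → G) {A B : Fin r → ℕ} {a b : GenComm r → ℤ}
    (l pre : List (GenComm r)) (hnd : l.Nodup)
    (hsort : l.Pairwise fun ξ η => ξ.totalWeight ≤ η.totalWeight)
    (hpre : ∀ π ∈ pre, ∀ ξ ∈ l, π.totalWeight ≤ ξ.totalWeight)
    (htriv : ∀ ζ : GenComm r, ζ ∉ pre → ζ ∉ l → ζ.eval x = 1)
    (ha : ∀ ξ ∈ l, |a ξ| ≤ (vecPow A ξ.weight : ℤ))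
    (hb : ∀ ξ ∈ l, |b ξ| ≤ (vecPow B ξ.weight : ℤ))
    (w : List (Symbol r)) (hold : (listWord a l).Sublist w) (hw : ∀ y ∈ w, y.1 ∉ pre)
    (hcnt : ∀ ζ : GenComm r, cnt ζ w + vecPow A ζ.weight + vecPow B ζ.weight ≤
      vecPow (A + B) ζ.weight + cnt ζ (listWord a l))
    (hnew : ∀ ξ ∈ l, ∀ ε η δ, cnt (comm ε η δ ξ) w ≤ cnt (comm ε η δ ξ) (listWord a l)) :
    ∃ c : GenComm r → ℤ, (∀ ξ ∈ l, |c ξ| ≤ (vecPow (A + B) ξ.weight : ℤ)) ∧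
      wordProd x w * (l.map fun ξ => ξ.eval x ^ b ξ).prod =
        (l.map fun ξ => ξ.eval x ^ c ξ).prod := by
  induction l generalizing pre w with
  | nil =>
    refine ⟨0, by simp, ?_⟩
    have : wordProd x w = 1 := by
      refine List.prod_eq_one fun g hg => ?_
      obtain ⟨y, hy, rfl⟩ := List.mem_map.1 hg
      rw [val, htriv y.1 (hw y hy) (by simp), one_zpow]
    simp [this]
  | cons ξ l ih =>
    rw [List.nodup_cons] at hnd
    rw [List.pairwise_cons] at hsort
    rw [listWord_cons, List.append_sublist_iff] at hold
    obtain ⟨r₁, r₂, rfl, hr₁, hr₂⟩ := hold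
    obtain ⟨m₁, hm₁, he₁⟩ := exists_wordProd_occ x ξ r₁
    obtain ⟨m₂, hm₂, he₂⟩ := exists_wordProd_occ x ξ r₂
    have hA : ∀ ζ, cnt ζ (listWord a l) ≤ vecPow A ζ.weight :=
      bounded_listWord hnd.2 fun ξ hξ => ha ξ (by simp [hξ])
    have haξ : (a ξ).natAbs ≤ vecPow A ξ.weight := by
      have := ha ξ (by simp)
      rw [Int.abs_eq_natAbs] at this
      exact_mod_cast this
    have hbξ : (b ξ).natAbs ≤ vecPow B ξ.weight := by
      have := hb ξ (by simp)
      rw [Int.abs_eq_natAbs] at this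
      exact_mod_cast this
    have hξcnt := hcnt ξ
    rw [listWord_cons, cnt_append, cnt_append, cnt_powWord, if_pos rfl, cnt_listWord hnd.2,
      if_neg hnd.1, add_zero] at hξcnt
    have hr₁' : (a ξ).natAbs ≤ cnt ξ r₁ := by
      simpa [cnt_powWord] using cnt_le_of_sublist ξ hr₁
    set R₁ := conj (occ ξ r₂ ++ powWord ξ (b ξ)) (extract ξ r₁) with hR₁
    set R₂ := conj (powWord ξ (b ξ)) (extract ξ r₂) with hR₂
    have hz : ∀ z ∈ occ ξ r₂ ++ powWord ξ (b ξ), ξ.totalWeight ≤ z.1.totalWeight := by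
      intro z hz
      rcases List.mem_append.1 hz with hz | hz
      · rw [(mem_occ.1 hz).2]
      · rw [List.eq_of_mem_replicate hz]
    -- What is left after `ξ` has been collected consists of old symbols and of heavier ones.
    have hmem : ∀ y ∈ R₁ ++ R₂, (y ∈ r₁ ++ r₂ ∧ y.1 ≠ ξ) ∨ 1 + ξ.totalWeight ≤ y.1.totalWeight := by
      intro y hy
      rcases List.mem_append.1 hy with hy | hy
      · rcases mem_conj (fun y _ => one_le_totalWeight y.1) hz hy with hy | hy
        · rcases mem_extract (fun y _ => one_le_totalWeight y.1) hy with hy | hy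
          · exact Or.inl ⟨List.mem_append_left _ hy.1, hy.2⟩
          · exact Or.inr hy
        · exact Or.inr hy
      · rcases mem_conj (fun y _ => one_le_totalWeight y.1)
          (fun z hz' => hz z (List.mem_append_right _ hz')) hy with hy | hy
        · rcases mem_extract (fun y _ => one_le_totalWeight y.1) hy with hy | hy
          · exact Or.inl ⟨List.mem_append_right _ hy.1, hy.2⟩
          · exact Or.inr hy
        · exact Or.inr hy
    have hξ0 : cnt ξ (R₁ ++ R₂) = 0 := by
      rw [cnt_eq_zero]
      rintro y hy rfl
      rcases hmem y hy with h | h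
      · exact h.2 rfl
      · omega
    have holdR : (listWord a l).Sublist R₂ := by
      refine List.Sublist.trans ?_ (sublist_conj _ _)
      refine List.Sublist.trans ?_ (filter_sublist_extract ξ r₂)
      have h := hr₂.filter fun y => y.1 ≠ ξ
      rwa [List.filter_eq_self.2] at h
      intro y hy
      have h0 : cnt ξ (listWord a l) = 0 := by rw [cnt_listWord hnd.2, if_neg hnd.1]
      simpa using cnt_eq_zero.1 h0 y hy
    have hR₁le : ∀ ζ, cnt ζ (extract ξ r₁) ≤ cnt ζ R₁ := fun ζ =>
      cnt_le_of_sublist ζ (sublist_conj _ _)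
    have hR₂le : ∀ ζ, cnt ζ (extract ξ r₂) ≤ cnt ζ R₂ := fun ζ =>
      cnt_le_of_sublist ζ (sublist_conj _ _)
    -- The number of commutators created when `ξ` is collected.
    have hcomm : ∀ ε η δ ξ', cnt (comm ε η δ ξ') (R₁ ++ R₂) ≤ cnt (comm ε η δ ξ') (r₁ ++ r₂) +
        if ξ = ξ' then cnt η R₁ * (cnt ξ r₁ + cnt ξ r₂ + (b ξ).natAbs) +
          cnt η R₂ * (cnt ξ r₂ + (b ξ).natAbs) else 0 := by
      intro ε η δ ξ'
      have h1 := cnt_comm_conj_le ε δ η ξ' (occ ξ r₂ ++ powWord ξ (b ξ)) (extract ξ r₁)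
      have h2 := cnt_comm_conj_le ε δ η ξ' (powWord ξ (b ξ)) (extract ξ r₂)
      have h3 := cnt_comm_extract_le ε δ η ξ' ξ r₁
      have h4 := cnt_comm_extract_le ε δ η ξ' ξ r₂
      have h5 := Nat.mul_le_mul_right (cnt ξ' (occ ξ r₁)) (hR₁le η)
      have h6 := Nat.mul_le_mul_right (cnt ξ' (occ ξ r₂)) (hR₂le η)
      rw [← hR₁] at h1
      rw [← hR₂] at h2
      simp only [cnt_append, cnt_occ, cnt_powWord] at *
      split_ifs at * with h
      · simp only [mul_add] at *
        omega
      · simp only [mul_zero, add_zero] at *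
        omega
    have hletter : ∀ i, cnt (letter i) (R₁ ++ R₂) ≤ cnt (letter i) (r₁ ++ r₂) := by
      intro i
      rw [cnt_append, cnt_append, hR₁, hR₂, cnt_letter_conj, cnt_letter_conj]
      exact add_le_add (cnt_letter_extract_le i ξ r₁) (cnt_letter_extract_le i ξ r₂)
    have hcntold : ∀ ζ, ζ ≠ ξ → cnt ζ (listWord a (ξ :: l)) = cnt ζ (listWord a l) := by
      intro ζ hζ
      rw [listWord_cons, cnt_append, cnt_powWord, if_neg hζ.symm, zero_add]
    have hcnt' : ∀ ζ : GenComm r, cnt ζ (R₁ ++ R₂) + vecPow A ζ.weight + vecPow B ζ.weight ≤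
        vecPow (A + B) ζ.weight + cnt ζ (listWord a l) := by
      intro ζ
      induction ζ with
      | letter i =>
        by_cases hζ : letter i = ξ
        · have := vecPow_add_le A B (letter i)
          rw [hζ] at *
          omega
        · have h1 := hcnt (letter i)
          rw [hcntold _ hζ] at h1
          have h2 := hletter i
          omega
      | comm ε η δ ξ' ihη _ =>
        by_cases hζ : comm ε η δ ξ' = ξ
        · have := vecPow_add_le A B (comm ε η δ ξ')
          rw [hζ] at *
          omega
        · have h1 := hcnt (comm ε η δ ξ')
          rw [hcntold _ hζ] at h1
          have h2 := hcomm ε η δ ξ'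
          split_ifs at h2 with h
          · subst h
            have h3 := hnew ξ (by simp) ε η δ
            rw [hcntold _ hζ] at h3
            rw [cnt_append (ξ := η)] at ihη
            have h4 := collecting_inequality ihη hξcnt (cnt_le_of_sublist η holdR) hr₁' (hA η)
              haξ hbξ
            rw [vecPow_comm, vecPow_comm, vecPow_comm]
            omega
          · omega
    have hnew' : ∀ ξ' ∈ l, ∀ ε η δ, cnt (comm ε η δ ξ') (R₁ ++ R₂) ≤
        cnt (comm ε η δ ξ') (listWord a l) := by
      intro ξ' hξ' ε η δ
      by_cases hζ : comm ε η δ ξ' = ξ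
      · rw [hζ]
        omega
      · have h1 := hcomm ε η δ ξ'
        rw [if_neg (by rintro rfl; exact hnd.1 hξ')] at h1
        have h2 := hnew ξ' (by simp [hξ']) ε η δ
        rw [hcntold _ hζ] at h2
        omega
    have hpreξ : ∀ π ∈ pre ++ [ξ], π.totalWeight ≤ ξ.totalWeight := by
      intro π hπ
      rcases List.mem_append.1 hπ with hπ | hπ
      · exact hpre π hπ ξ (by simp)
      · rw [List.mem_singleton.1 hπ]
    obtain ⟨c, hc, hprod⟩ := ih (pre ++ [ξ]) hnd.2 hsort.2
      (fun π hπ η hη => (hpreξ π hπ).trans (hsort.1 η hη))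
      (fun ζ h1 h2 => htriv ζ (fun h => h1 (by simp [h])) (fun h => by
        rcases List.mem_cons.1 h with rfl | h
        · exact h1 (by simp)
        · exact h2 h))
      (fun η hη => ha η (by simp [hη])) (fun η hη => hb η (by simp [hη])) (R₁ ++ R₂)
      (holdR.trans (List.sublist_append_right _ _))
      (fun y hy hmem' => by
        rcases hmem y hy with h | h
        · rcases List.mem_append.1 hmem' with h' | h'
          · exact hw y h.1 h'
          · exact h.2 (List.mem_singleton.1 h')
        · have := hpreξ _ hmem'
          omega)
      hcnt' hnew'
    refine ⟨fun ζ => if ζ = ξ then m₁ + m₂ + b ξ else c ζ, ?_, ?_⟩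
    · intro ζ hζ
      by_cases h : ζ = ξ
      · subst h
        simp only [if_true]
        have h1 := abs_add_le (m₁ + m₂) (b ζ)
        have h2 := abs_add_le m₁ m₂
        rw [Int.abs_eq_natAbs (b ζ)] at h1
        omega
      · simp only [if_neg h]
        exact hc ζ ((List.mem_cons.1 hζ).resolve_left h)
    · have hmap : (l.map fun ζ => ζ.eval x ^ (if ζ = ξ then m₁ + m₂ + b ξ else c ζ)) =
          l.map fun ζ => ζ.eval x ^ c ζ := by
        refine List.map_congr_left fun ζ hζ => ?_
        rw [if_neg]
        rintro rfl
        exact hnd.1 hζ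
      rw [List.map_cons, List.prod_cons, List.map_cons, List.prod_cons, hmap, ← hprod,
        wordProd_append, wordProd_extract x ξ r₁, wordProd_extract x ξ r₂, wordProd_append, hR₁,
        hR₂, wordProd_conj, wordProd_conj, wordProd_append, wordProd_powWord, he₁, he₂]
      simp only [if_true]
      group

end Words

end GenComm

theorem nilcompleteProgression_mul_subset {G : Type*} [Group G] [Group.IsNilpotent G] {r s : ℕ}
    (hs : Group.nilpotencyClass G ≤ s) {ord : LinearOrder (GenComm r)}
    (hord : GenComm.IsAdmissible ord) (x : Fin r → G) (A B : Fin r → ℕ) :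
    nilcompleteProgression ord s x A * nilcompleteProgression ord s x B ⊆
      nilcompleteProgression ord s x (A + B) := by
  rintro _ ⟨_, ⟨a, ha, rfl⟩, _, ⟨b, hb, rfl⟩, rfl⟩
  have hnd := GenComm.nodup_orderedList ord s
  obtain ⟨c, hc, h⟩ := GenComm.exists_wordProd_mul_eq x (A := A) (B := B) (a := a) (b := b)
    (GenComm.orderedList ord s) [] hnd (GenComm.pairwise_orderedList hord s) (by simp)
    (fun ζ _ hζ => GenComm.eval_eq_one_of_nilpotencyClass_lt x
      (hs.trans_lt (not_le.1 fun h => hζ (GenComm.mem_orderedList.2 h))))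
    ha hb _ (List.Sublist.refl _) (by simp)
    (fun ζ => by have := vecPow_add_le A B ζ; omega) (fun _ _ _ _ _ => le_rfl)
  rw [GenComm.wordProd_listWord] at h
  exact ⟨c, hc, h⟩

theorem one_mem_nilcompleteProgression {G : Type*} [Group G] {r s : ℕ}
    (ord : LinearOrder (GenComm r)) (x : Fin r → G) (L : Fin r → ℕ) :
    1 ∈ nilcompleteProgression ord s x L :=
  ⟨0, by simp, by simp⟩

theorem nilcompleteProgression_pow_subset {G : Type*} [Group G] [Group.IsNilpotent G] {r s : ℕ}
    (hs : Group.nilpotencyClass G ≤ s) {ord : LinearOrder (GenComm r)}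
    (hord : GenComm.IsAdmissible ord) (x : Fin r → G) (L : Fin r → ℕ) (n : ℕ) :
    nilcompleteProgression ord s x L ^ n ⊆ nilcompleteProgression ord s x (n • L) := by
  induction n with
  | zero => simpa using one_mem_nilcompleteProgression ord x _
  | succ n ih =>
    rw [pow_succ, succ_nsmul]
    exact (Set.mul_subset_mul_right ih).trans (nilcompleteProgression_mul_subset hs hord x _ _)

/-! ### Covering a dilate by boundedly many translates -/

namespace GenComm

section Words

open scoped Classical

variable {r : ℕ}

/-- Every word with bounds `c • L` lies in the ordered progression over `l` times a set whose size
is bounded in terms of `c`, `s` and the length of `l`: if `ξ` occurs to the total power `m`, write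
`m = ρ + q D` with `D = L ^ χ(ξ)` and `0 ≤ ρ < D`, leave `ξ ^ ρ` at the front and move `ξ ^ (q D)`
to the far right. The generalised commutators in `pre` have been treated already. -/
theorem exists_covering (s k : ℕ) : ∀ c : ℕ, ∃ K : ℕ, ∀ {G : Type*} [Group G] (x : Fin r → G)
    (L : Fin r → ℕ), (∀ i, 0 < L i) → ∀ l pre : List (GenComm r), l.length = k → l.Nodup →
    (∀ ξ ∈ l, ξ.totalWeight ≤ s) →
    l.Pairwise (fun ξ η => ξ.totalWeight ≤ η.totalWeight) →
    (∀ π ∈ pre, ∀ ξ ∈ l, π.totalWeight ≤ ξ.totalWeight) →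
    (∀ ζ : GenComm r, ζ ∉ pre → ζ ∉ l → ζ.eval x = 1) →
    ∃ X : Finset G, X.card ≤ K ∧ ∀ w : List (Symbol r), Bounded (c • L) w →
      (∀ y ∈ w, y.1 ∉ pre) →
      ∃ ρ : GenComm r → ℤ, (∀ ξ ∈ l, |ρ ξ| ≤ (vecPow L ξ.weight : ℤ)) ∧
        ∃ g ∈ X, wordProd x w = (l.map fun ξ => ξ.eval x ^ ρ ξ).prod * g := by
  induction k with
  | zero =>
    refine fun c => ⟨1, fun {G} _ x L _ l pre hl _ _ _ _ htriv => ⟨{1}, by simp, fun w _ hw => ?_⟩⟩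
    rw [List.length_eq_zero_iff] at hl
    subst hl
    refine ⟨0, by simp, 1, by simp, ?_⟩
    have : wordProd x w = 1 := by
      refine List.prod_eq_one fun g hg => ?_
      obtain ⟨y, hy, rfl⟩ := List.mem_map.1 hg
      rw [val, htriv y.1 (hw y hy) (by simp), one_zpow]
    simp [this]
  | succ k ih =>
    intro c
    obtain ⟨K, hK⟩ := ih (2 * c + (c + 1))
    refine ⟨K * (2 * (c + 1) ^ s + 1), fun {G} _ x L hL l pre hl hnd hs hsort hpre htriv => ?_⟩
    obtain _ | ⟨ξ, l⟩ := l
    · simp at hl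
    rw [List.nodup_cons] at hnd
    rw [List.pairwise_cons] at hsort
    have hpreξ : ∀ π ∈ pre ++ [ξ], π.totalWeight ≤ ξ.totalWeight := by
      intro π hπ
      rcases List.mem_append.1 hπ with hπ | hπ
      · exact hpre π hπ ξ (by simp)
      · rw [List.mem_singleton.1 hπ]
    obtain ⟨X, hX, hcov⟩ := hK x L hL l (pre ++ [ξ]) (by simpa using hl) hnd.2
      (fun η hη => hs η (by simp [hη])) hsort.2
      (fun π hπ η hη => (hpreξ π hπ).trans (hsort.1 η hη))
      (fun ζ h1 h2 => htriv ζ (fun h => h1 (by simp [h])) (fun h => by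
        rcases List.mem_cons.1 h with rfl | h
        · exact h1 (by simp)
        · exact h2 h))
    set D : ℤ := (vecPow L ξ.weight : ℤ) with hD
    have hD0 : 0 < D := Int.natCast_pos.2 (vecPow_pos hL ξ.weight)
    set Q : ℕ := (c + 1) ^ s with hQ
    refine ⟨Finset.image₂ (fun g q => g * ξ.eval x ^ (q * D)) X (Finset.Icc (-Q : ℤ) Q), ?_, ?_⟩
    · refine (Finset.card_image₂_le _ _ _).trans (Nat.mul_le_mul hX (le_of_eq ?_))
      rw [Int.card_Icc]
      omega
    intro w hbd hw
    obtain ⟨m, hm, he⟩ := exists_wordProd_occ x ξ w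
    have hmD : |m| ≤ (c : ℤ) ^ ξ.totalWeight * D := by
      have h := hbd ξ
      rw [vecPow_nsmul] at h
      refine hm.trans ?_
      rw [hD]
      exact_mod_cast h
    have hdiv : m % D + m / D * D = m := by
      rw [mul_comm]
      exact Int.emod_add_mul_ediv m D
    have hρ0 := Int.emod_nonneg m hD0.ne'
    have hρ1 := Int.emod_lt_of_pos m hD0
    have hqD : |m / D * D| ≤ ((c + 1 : ℕ) : ℤ) ^ ξ.totalWeight * D := by
      have h1 : |m / D * D| ≤ |m| + D := by
        have h : m / D * D = m - m % D := by omega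
        rw [h]
        refine (abs_sub _ _).trans ?_
        rw [abs_of_nonneg hρ0]
        omega
      have h2 : c ^ ξ.totalWeight + 1 ≤ (c + 1) ^ ξ.totalWeight :=
        Nat.pow_lt_pow_left (Nat.lt_succ_self c) (Nat.one_le_iff_ne_zero.1 (one_le_totalWeight ξ))
      calc |m / D * D| ≤ (c : ℤ) ^ ξ.totalWeight * D + 1 * D := by linarith
        _ = ((c : ℤ) ^ ξ.totalWeight + 1) * D := by ring
        _ ≤ _ := mul_le_mul_of_nonneg_right (by exact_mod_cast h2) hD0.le
    have hq : |m / D| ≤ Q := by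
      rw [abs_mul, abs_of_pos hD0] at hqD
      refine (le_of_mul_le_mul_right hqD hD0).trans ?_
      rw [hQ]
      exact_mod_cast Nat.pow_le_pow_right (Nat.succ_pos c) (hs ξ (by simp))
    have hpow : Bounded ((c + 1) • L) (powWord ξ (-(m / D * D))) := by
      refine bounded_powWord ?_
      rw [abs_neg, vecPow_nsmul]
      push_cast at hqD ⊢
      exact hqD
    have hR : Bounded ((2 * c + (c + 1)) • L)
        (conj (powWord ξ (-(m / D * D))) (extract ξ w)) := by
      rw [add_nsmul, mul_nsmul']
      exact (hbd.extract ξ).conj hpow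
    obtain ⟨ρ, hρ, g, hg, hprod⟩ := hcov _ hR (fun y hy hmem => by
      rcases mem_conj (fun y _ => one_le_totalWeight y.1) (e := ξ.totalWeight)
        (fun z hz => by rw [List.eq_of_mem_replicate hz]) hy with h | h
      · rcases mem_extract (fun y _ => one_le_totalWeight y.1) h with h | h
        · rcases List.mem_append.1 hmem with h' | h'
          · exact hw y h.1 h'
          · exact h.2 (List.mem_singleton.1 h')
        · have := hpreξ _ hmem
          omega
      · have := hpreξ _ hmem
        omega)
    refine ⟨fun ζ => if ζ = ξ then m % D else ρ ζ, ?_, g * ξ.eval x ^ (m / D * D), ?_, ?_⟩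
    · intro ζ hζ
      by_cases h : ζ = ξ
      · subst h
        simp only [if_true]
        rw [abs_of_nonneg hρ0]
        exact hρ1.le
      · simp only [if_neg h]
        exact hρ ζ ((List.mem_cons.1 hζ).resolve_left h)
    · exact Finset.mem_image₂_of_mem hg (Finset.mem_Icc.2 (abs_le.1 hq))
    · have hmap : (l.map fun ζ => ζ.eval x ^ (if ζ = ξ then m % D else ρ ζ)) =
          l.map fun ζ => ζ.eval x ^ ρ ζ := by
        refine List.map_congr_left fun ζ hζ => ?_
        rw [if_neg]
        rintro rfl
        exact hnd.1 hζ
      rw [wordProd_conj, wordProd_powWord] at hprod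
      have hm' : ξ.eval x ^ m = ξ.eval x ^ (m % D) * ξ.eval x ^ (m / D * D) := by
        rw [← zpow_add, hdiv]
      rw [List.map_cons, List.prod_cons, hmap, wordProd_extract x ξ w, he, hm']
      simp only [if_true]
      rw [mul_assoc, mul_assoc, ← mul_assoc (List.prod _), ← hprod]
      group

end Words

end GenComm

theorem exists_nilcompleteProgression_nsmul_subset (r s M : ℕ) :
    ∃ K : ℕ, ∀ (G : Type*) [Group G] [Group.IsNilpotent G], Group.nilpotencyClass G ≤ s →
      ∀ (ord : LinearOrder (GenComm r)), GenComm.IsAdmissible ord →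
      ∀ (x : Fin r → G) (L : Fin r → ℕ), (∀ i, 0 < L i) →
        ∃ X : Finset G, X.card ≤ K ∧ nilcompleteProgression ord s x (M • L) ⊆
          nilcompleteProgression ord s x L * (X : Set G) := by
  obtain ⟨K, hK⟩ := GenComm.exists_covering (r := r) s (GenComm.upTo r s).card M
  refine ⟨K, fun G _ _ hG ord hord x L hL => ?_⟩
  have hnd := GenComm.nodup_orderedList ord s
  obtain ⟨X, hX, h⟩ := hK x L hL (GenComm.orderedList ord s) [] (GenComm.length_orderedList ord s)
    hnd (fun ξ hξ => GenComm.mem_orderedList.1 hξ) (GenComm.pairwise_orderedList hord s) (by simp)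
    (fun ζ _ hζ => GenComm.eval_eq_one_of_nilpotencyClass_lt x
      (hG.trans_lt (not_le.1 fun h => hζ (GenComm.mem_orderedList.2 h))))
  refine ⟨X, hX, ?_⟩
  rintro _ ⟨a, ha, rfl⟩
  obtain ⟨ρ, hρ, g, hg, he⟩ := h _ (GenComm.bounded_listWord hnd ha) (by simp)
  rw [GenComm.wordProd_listWord] at he
  exact ⟨_, ⟨ρ, hρ, rfl⟩, g, hg, he.symm⟩

/-! ### Commutators of words -/

namespace GenComm

section Words

open scoped Classical

universe u

variable {G : Type*} [Group G] {r : ℕ}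

/-- The formal inverse of a word. -/
def invWord (p : List (Symbol r)) : List (Symbol r) := (p.map fun y => (y.1, -y.2)).reverse

theorem invWord_cons (y : Symbol r) (p : List (Symbol r)) :
    invWord (y :: p) = invWord p ++ [(y.1, -y.2)] := by simp [invWord]

theorem wordProd_invWord (x : Fin r → G) (p : List (Symbol r)) :
    wordProd x (invWord p) = (wordProd x p)⁻¹ := by
  induction p with
  | nil => simp [invWord]
  | cons y p ih => simp [invWord_cons, ih, val]

theorem cnt_invWord (ζ : GenComm r) (p : List (Symbol r)) : cnt ζ (invWord p) = cnt ζ p := by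
  induction p with
  | nil => rfl
  | cons y p ih => simp [invWord_cons, ih, cnt_cons]

theorem Bounded.invWord {N : Fin r → ℕ} {p : List (Symbol r)} (h : Bounded N p) :
    Bounded N (invWord p) := fun ζ => by
  rw [cnt_invWord]
  exact h ζ

theorem mem_invWord {p : List (Symbol r)} {y : Symbol r} (hy : y ∈ invWord p) :
    ∃ z ∈ p, z.1 = y.1 := by
  simp only [GenComm.invWord, List.mem_reverse, List.mem_map] at hy
  obtain ⟨z, hz, rfl⟩ := hy
  exact ⟨z, hz, rfl⟩

/-- The symbols of weight at most `d` of a word. -/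
def lead (d : ℕ) (p : List (Symbol r)) : List (Symbol r) :=
  p.filter fun y => y.1.totalWeight ≤ d

@[simp] theorem lead_append (d : ℕ) (p q : List (Symbol r)) :
    lead d (p ++ q) = lead d p ++ lead d q := by simp [lead]

theorem lead_cons (d : ℕ) (y : Symbol r) (p : List (Symbol r)) :
    lead d (y :: p) = if y.1.totalWeight ≤ d then y :: lead d p else lead d p := by
  simp [lead, List.filter_cons]

theorem lead_eq_nil {d : ℕ} {p : List (Symbol r)} (h : ∀ y ∈ p, d < y.1.totalWeight) :
    lead d p = [] := by
  simpa [lead, List.filter_eq_nil_iff] using fun a b hy => h (a, b) hy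

theorem lead_pass {d : ℕ} {p : List (Symbol r)} (hp : ∀ y ∈ p, d ≤ y.1.totalWeight)
    (z : Symbol r) : lead d (pass z p) = lead d p := by
  induction p with
  | nil => rfl
  | cons y p ih =>
    have h1 := hp y (by simp)
    have h2 := one_le_totalWeight z.1
    rw [pass_cons, lead_cons, lead_cons, lead_cons, ih fun y hy => hp y (by simp [hy]),
      totalWeight_bracket, if_neg (c := _ + _ ≤ d) (by omega)]

theorem le_totalWeight_of_mem_conj {d : ℕ} {zs p : List (Symbol r)}
    (hp : ∀ y ∈ p, d ≤ y.1.totalWeight) : ∀ y ∈ conj zs p, d ≤ y.1.totalWeight := by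
  intro y hy
  rcases mem_conj hp (fun z _ => one_le_totalWeight z.1) hy with h | h
  · exact hp y h
  · omega

theorem lead_conj {d : ℕ} {p : List (Symbol r)} (hp : ∀ y ∈ p, d ≤ y.1.totalWeight)
    (zs : List (Symbol r)) : lead d (conj zs p) = lead d p := by
  induction zs generalizing p with
  | nil => rfl
  | cons z zs ih =>
    rw [conj_cons, ih (p := pass z p) (le_totalWeight_of_mem_conj (zs := [z]) hp), lead_pass hp]

theorem lead_invWord {d n : ℕ} {ξ : GenComm r} {ε : ℤˣ} {p : List (Symbol r)}
    (h : lead d p = List.replicate n (ξ, ε)) : lead d (invWord p) = List.replicate n (ξ, -ε) := by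
  have : lead d (invWord p) = invWord (lead d p) := by
    clear h
    induction p with
    | nil => rfl
    | cons y p ih =>
      rw [invWord_cons, lead_append, ih, lead_cons, lead_cons]
      split_ifs with h
      · rw [invWord_cons]; rfl
      · simp [lead]
  rw [this, h]
  simp [invWord]

/-- The word of the commutator `[y, v]` of a symbol and a word. -/
def symbolCommutator (y : Symbol r) : List (Symbol r) → List (Symbol r)
  | [] => []
  | z :: v => symbolCommutator y v ++ conj v [bracket y z]

/-- The word of the commutator `[u, v] = u⁻¹ v⁻¹ u v` of two words. -/
def wordCommutator : List (Symbol r) → List (Symbol r) → List (Symbol r)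
  | [], _ => []
  | y :: u, v => conj u (symbolCommutator y v) ++ wordCommutator u v

theorem conj_singleton (y : Symbol r) (v : List (Symbol r)) :
    conj v [y] = y :: symbolCommutator y v := by
  induction v with
  | nil => rfl
  | cons z v ih =>
    rw [conj_cons, pass_cons, pass_nil, conj_cons_right, ih]
    rfl

theorem wordProd_wordCommutator (x : Fin r → G) (u v : List (Symbol r)) :
    wordProd x (wordCommutator u v) =
      (wordProd x u)⁻¹ * (wordProd x v)⁻¹ * wordProd x u * wordProd x v := by
  induction u with
  | nil => simp [wordCommutator]
  | cons y u ih =>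
    have h := wordProd_conj x v [y]
    rw [conj_singleton, wordProd_cons, wordProd_cons, wordProd_nil, mul_one] at h
    rw [wordCommutator, wordProd_append, wordProd_conj, ih, eq_inv_mul_of_mul_eq h, wordProd_cons]
    group

theorem flatMap_symbolCommutator_sublist (u v : List (Symbol r)) :
    (u.flatMap fun y => symbolCommutator y v).Sublist (conj v u) := by
  induction u with
  | nil => simp
  | cons y u ih =>
    rw [List.flatMap_cons, conj_cons_right, conj_singleton]
    exact (List.sublist_cons_self _ _).append ih

theorem wordCommutator_sublist {u u' : List (Symbol r)} (h : u.Sublist u') (v : List (Symbol r)) :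
    (wordCommutator u v).Sublist (conj u' (u.flatMap fun y => symbolCommutator y v)) := by
  induction u with
  | nil => simp [wordCommutator]
  | cons y u ih =>
    have h' := (List.sublist_cons_self y u).trans h
    rw [wordCommutator, List.flatMap_cons, conj_append]
    exact (conj_sublist_conj_left h' _).append (ih h')

theorem Bounded.wordCommutator {N N' : Fin r → ℕ} {u v : List (Symbol r)} (hu : Bounded N u)
    (hv : Bounded N' v) : Bounded (N + N' + N) (wordCommutator u v) :=
  (((hu.conj hv).sublist (flatMap_symbolCommutator_sublist u v)).conj hu).sublist
    (wordCommutator_sublist (List.Sublist.refl u) v)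

theorem le_totalWeight_symbolCommutator {y : Symbol r} {v : List (Symbol r)} {d e : ℕ}
    (hy : d ≤ y.1.totalWeight) (hv : ∀ z ∈ v, e ≤ z.1.totalWeight) :
    ∀ t ∈ symbolCommutator y v, d + e ≤ t.1.totalWeight := by
  induction v with
  | nil => simp [symbolCommutator]
  | cons z v ih =>
    intro t ht
    rcases List.mem_append.1 ht with ht | ht
    · exact ih (fun z hz => hv z (by simp [hz])) t ht
    · refine le_totalWeight_of_mem_conj (p := [bracket y z]) ?_ t ht
      intro t ht
      rw [List.mem_singleton.1 ht, totalWeight_bracket]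
      exact add_le_add hy (hv z (by simp))

theorem lead_symbolCommutator {y : Symbol r} {v : List (Symbol r)} {d : ℕ}
    (hv : ∀ z ∈ v, d ≤ z.1.totalWeight) :
    lead (y.1.totalWeight + d) (symbolCommutator y v) = ((lead d v).map (bracket y)).reverse := by
  induction v with
  | nil => rfl
  | cons z v ih =>
    have hz := hv z (by simp)
    rw [symbolCommutator, lead_append, ih fun z hz => hv z (by simp [hz]), lead_conj, lead_cons,
      lead_cons, totalWeight_bracket]
    · split_ifs with h1 h2 h2
      · simp [lead]
      · omega
      · omega
      · simp [lead]
    · intro t ht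
      rw [List.mem_singleton.1 ht, totalWeight_bracket]
      omega

/-- The commutator of `y ^ m ⋯` and `z ^ n ⋯`, where the dots stand for symbols of higher weight,
is `[y, z] ^ (m n) ⋯`. -/
theorem lead_wordCommutator {d e m n : ℕ} {y z : Symbol r} {u v : List (Symbol r)}
    (hu : lead d u = List.replicate m y) (hv : lead e v = List.replicate n z)
    (hud : ∀ y ∈ u, d ≤ y.1.totalWeight) (hve : ∀ z ∈ v, e ≤ z.1.totalWeight) :
    lead (d + e) (wordCommutator u v) = List.replicate (m * n) (bracket y z) := by
  induction u generalizing m with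
  | nil =>
    obtain rfl : m = 0 := by simpa [lead] using hu.symm
    simp [wordCommutator, lead]
  | cons t u ih =>
    have ht := hud t (by simp)
    have hud' : ∀ y ∈ u, d ≤ y.1.totalWeight := fun y hy => hud y (by simp [hy])
    rw [wordCommutator, lead_append, lead_conj (le_totalWeight_symbolCommutator ht hve)]
    rw [lead_cons] at hu
    split_ifs at hu with h
    · obtain ⟨m, rfl⟩ : ∃ k, m = k + 1 := Nat.exists_eq_succ_of_ne_zero (by rintro rfl; simp at hu)
      rw [List.replicate_succ, List.cons.injEq] at hu
      obtain rfl := hu.1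
      have hd : t.1.totalWeight = d := le_antisymm h ht
      rw [ih hu.2 hud']
      conv_lhs => enter [1, 1, 1]; rw [← hd]
      rw [lead_symbolCommutator hve, hv, List.map_replicate, List.reverse_replicate,
        List.replicate_append_replicate]
      congr 1
      ring
    · rw [ih hu hud', lead_eq_nil, List.nil_append]
      intro y hy
      have := le_totalWeight_symbolCommutator (d := d + 1) (by omega) hve y hy
      omega

/-! ### Powers of generalised commutators as products of short commutators -/

/-- `IsMonomial x N ξ m g` says that `g` arises from the generalised commutator `ξ` when each
occurrence of a letter `x_i` is replaced by a power `x_i ^ k` with `0 ≤ k ≤ N_i`, and that `m` is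
the product of these exponents `k`. Modulo terms of higher weight, `g` is then `ξ ^ m`. -/
inductive IsMonomial (x : Fin r → G) (N : Fin r → ℕ) : GenComm r → ℕ → G → Prop
  | letter (i : Fin r) (k : ℕ) (hk : k ≤ N i) : IsMonomial x N (letter i) k (x i ^ k)
  | comm (ε δ : ℤˣ) {ξ η : GenComm r} {m n : ℕ} {g h : G} (hg : IsMonomial x N ξ m g)
      (hh : IsMonomial x N η n h) : IsMonomial x N (comm ε ξ δ η) (m * n)
        ((g ^ (ε : ℤ))⁻¹ * (h ^ (δ : ℤ))⁻¹ * g ^ (ε : ℤ) * h ^ (δ : ℤ))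

theorem exists_isMonomial_vecPow (x : Fin r → G) (N : Fin r → ℕ) (ξ : GenComm r) :
    ∃ g, IsMonomial x N ξ (vecPow N ξ.weight) g := by
  induction ξ with
  | letter i =>
    rw [vecPow_letter]
    exact ⟨_, .letter i _ le_rfl⟩
  | comm ε a δ b iha ihb =>
    obtain ⟨g, hg⟩ := iha
    obtain ⟨h, hh⟩ := ihb
    rw [vecPow_comm]
    exact ⟨_, .comm ε δ hg hh⟩

theorem exists_isMonomial_one (x : Fin r → G) {N : Fin r → ℕ} (hN : ∀ i, 0 < N i)
    (ξ : GenComm r) : ∃ g, IsMonomial x N ξ 1 g := by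
  induction ξ with
  | letter i => exact ⟨_, .letter i 1 (hN i)⟩
  | comm ε a δ b iha ihb =>
    obtain ⟨g, hg⟩ := iha
    obtain ⟨h, hh⟩ := ihb
    exact ⟨_, .comm ε δ hg hh⟩

/-- Every `m ≤ N ^ χ(ξ)` is a sum of `|χ(ξ)|` products of leaf exponents; this is the expansion of
`m` in a mixed radix. -/
theorem exists_sum_isMonomial (x : Fin r → G) {N : Fin r → ℕ} (hN : ∀ i, 0 < N i)
    (ξ : GenComm r) {m : ℕ} (hm : m ≤ vecPow N ξ.weight) :
    ∃ ms : List ℕ, ms.length = ξ.totalWeight ∧ ms.sum = m ∧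
      ∀ k ∈ ms, ∃ g, IsMonomial x N ξ k g := by
  induction ξ generalizing m with
  | letter i =>
    rw [vecPow_letter] at hm
    refine ⟨[m], by simp [totalWeight_letter], by simp, ?_⟩
    intro k hk
    rw [List.mem_singleton.1 hk]
    exact ⟨_, .letter i m hm⟩
  | comm ε a δ b iha ihb =>
    rw [vecPow_comm] at hm
    have hb := vecPow_pos hN b.weight
    set D := vecPow N b.weight with hD
    obtain ⟨qs, hql, hqs, hq⟩ := iha (m := m / D) (Nat.div_le_of_le_mul (by rwa [mul_comm]))
    obtain ⟨ks, hkl, hks, hk⟩ := ihb (m := m % D) (Nat.mod_lt _ hb).le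
    refine ⟨qs.map (· * D) ++ ks, ?_, ?_, ?_⟩
    · simp [hql, hkl, totalWeight_comm]
    · rw [List.sum_append, List.sum_map_mul_right, List.map_id', hqs, hks]
      exact Nat.div_add_mod' m D
    · intro k hk'
      rcases List.mem_append.1 hk' with hk' | hk'
      · obtain ⟨q, hq', rfl⟩ := List.mem_map.1 hk'
        obtain ⟨g, hg⟩ := hq q hq'
        obtain ⟨h, hh⟩ := exists_isMonomial_vecPow x N b
        exact ⟨_, .comm ε δ hg hh⟩
      · obtain ⟨g, hg⟩ := exists_isMonomial_one x hN a
        obtain ⟨h, hh⟩ := hk k hk'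
        have := IsMonomial.comm ε δ hg hh
        rw [one_mul] at this
        exact ⟨_, this⟩

theorem le_totalWeight_of_lead {d n : ℕ} {ξ : GenComm r} {ε : ℤˣ} {p : List (Symbol r)}
    (hξ : d ≤ ξ.totalWeight) (h : lead d p = List.replicate n (ξ, ε)) :
    ∀ y ∈ p, d ≤ y.1.totalWeight := by
  intro y hy
  by_contra hlt
  have : y ∈ lead d p := by
    rw [lead, List.mem_filter]
    exact ⟨hy, by simpa using by omega⟩
  rw [h] at this
  rw [List.eq_of_mem_replicate this] at hlt
  exact hlt hξ

/-- An element arising from `ξ` by replacing the letters by powers is represented by a word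
`ξ ^ m ⋯`, with the dots standing for a controlled number of symbols of higher weight. -/
theorem IsMonomial.exists_word (ξ : GenComm r) : ∃ c : ℕ, ∀ {G : Type u} [Group G]
    (x : Fin r → G) (N : Fin r → ℕ) (m : ℕ) (g : G), IsMonomial x N ξ m g →
    ∃ p, wordProd x p = g ∧ lead ξ.totalWeight p = List.replicate m (ξ, 1) ∧
      Bounded (c • N) p := by
  induction ξ with
  | letter i =>
    refine ⟨1, fun x N m g h => ?_⟩
    obtain ⟨_, _, hm⟩ := h
    refine ⟨List.replicate m (.letter i, 1), ?_, ?_, ?_⟩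
    · simp [wordProd_replicate, val, eval]
    · simp [lead]
    · intro ζ
      rw [cnt_replicate, one_nsmul]
      split_ifs with h
      · subst h
        rwa [vecPow_letter]
      · exact Nat.zero_le _
  | comm ε a δ b iha ihb =>
    obtain ⟨c, hc⟩ := iha
    obtain ⟨c', hc'⟩ := ihb
    refine ⟨c + c' + c, fun x N k g h => ?_⟩
    -- A word for `g ^ ε` is obtained from one for `g`.
    have hsign : ∀ {c : ℕ} {a : GenComm r} {m : ℕ} {g} (ε : ℤˣ) (p : List (Symbol r)),
        wordProd x p = g → lead a.totalWeight p = List.replicate m (a, 1) → Bounded (c • N) p →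
        ∃ q, wordProd x q = g ^ (ε : ℤ) ∧ lead a.totalWeight q = List.replicate m (a, ε) ∧
          Bounded (c • N) q := by
      intro c a m g ε p hp hl hb
      rcases Int.units_eq_one_or ε with rfl | rfl
      · exact ⟨p, by simp [hp], hl, hb⟩
      · exact ⟨invWord p, by simp [wordProd_invWord, hp], lead_invWord hl, hb.invWord⟩
    obtain _ | ⟨_, _, hg, hh⟩ := h
    obtain ⟨p, hp, hl, hb⟩ := hc x N _ _ hg
    obtain ⟨p', hp', hl', hb'⟩ := hc' x N _ _ hh
    obtain ⟨q, hq, hql, hqb⟩ := hsign ε p hp hl hb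
    obtain ⟨q', hq', hql', hqb'⟩ := hsign δ p' hp' hl' hb'
    refine ⟨wordCommutator q q', ?_, ?_, ?_⟩
    · rw [wordProd_wordCommutator, hq, hq']
    · rw [totalWeight_comm]
      exact lead_wordCommutator hql hql' (le_totalWeight_of_lead le_rfl hql)
        (le_totalWeight_of_lead le_rfl hql')
    · rw [add_nsmul, add_nsmul]
      exact hqb.wordCommutator hqb'

theorem IsMonomial.exists_pow_mul (ξ : GenComm r) : ∃ c : ℕ, ∀ {G : Type u} [Group G]
    (x : Fin r → G) (N : Fin r → ℕ) (m : ℕ) (g : G), IsMonomial x N ξ m g →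
    ∃ w, g = ξ.eval x ^ m * wordProd x w ∧ (∀ y ∈ w, ξ.totalWeight + 1 ≤ y.1.totalWeight) ∧
      Bounded (c • N) w := by
  obtain ⟨c, hc⟩ := IsMonomial.exists_word.{u} ξ
  refine ⟨2 * c, fun x N m g h => ?_⟩
  obtain ⟨p, rfl, hl, hb⟩ := hc x N m g h
  have hlow : ∀ y ∈ p, y.1.totalWeight ≤ ξ.totalWeight → y = (ξ, 1) := by
    intro y hy hle
    refine List.eq_of_mem_replicate (n := m) ?_
    rw [← hl, lead, List.mem_filter]
    exact ⟨hy, by simpa using hle⟩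
  have hocc : occ ξ p = List.replicate m (ξ, 1) := by
    have h1 : occ ξ (lead ξ.totalWeight p) = occ ξ p := by
      rw [occ, occ, lead, List.filter_filter]
      refine List.filter_congr fun y _ => ?_
      by_cases h : y.1 = ξ <;> simp [h]
    rw [← h1, hl]
    simp [occ]
  refine ⟨extract ξ p, ?_, ?_, ?_⟩
  · rw [wordProd_extract x ξ p, hocc, wordProd_replicate]
    simp [val]
  · intro y hy
    rcases mem_extract (fun y _ => one_le_totalWeight y.1) hy with h | h
    · by_contra hlt
      exact h.2 (by rw [hlow y h.1 (by omega)])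
    · omega
  · rw [mul_nsmul']
    exact hb.extract ξ

end Words

end GenComm

/-! ### Expressing bounded words by few factors -/

namespace GenComm

section Words

open scoped Classical

universe u

variable {r : ℕ}

/-- The properties of `P = P̄(x₁, …, x_r; L)` that are needed in order to write long words as
products of few elements of `P`: it contains `1` and the powers `x_i ^ m` with `|m| ≤ L_i`. The
ambient group is assumed to kill the generalised commutators of total weight more than `s`. -/
structure ContainsPowers {G : Type u} [Group G] (s : ℕ) (x : Fin r → G) (L : Fin r → ℕ)
    (P : Set G) : Prop where
  eval_eq_one : ∀ ζ : GenComm r, s < ζ.totalWeight → ζ.eval x = 1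
  pos : ∀ i, 0 < L i
  one_mem : 1 ∈ P
  zpow_mem : ∀ (i : Fin r) (m : ℤ), |m| ≤ (L i : ℤ) → x i ^ m ∈ P

section

variable {G : Type u} [Group G] {s : ℕ} {x : Fin r → G} {L : Fin r → ℕ} {P : Set G}

theorem ContainsPowers.pow_subset (h : ContainsPowers s x L P) {m n : ℕ} (hmn : m ≤ n) :
    P ^ m ⊆ P ^ n := Set.pow_subset_pow_right h.one_mem hmn

theorem ContainsPowers.zpow_mem_pow (h : ContainsPowers s x L P) (i : Fin r) (n : ℕ) (m : ℤ)
    (hm : |m| ≤ (n : ℤ) * L i) : x i ^ m ∈ P ^ n := by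
  induction n generalizing m with
  | zero =>
    obtain rfl : m = 0 := by simpa using hm
    simp
  | succ n ih =>
    push_cast at hm
    rw [add_mul, one_mul] at hm
    have hL : (0 : ℤ) < L i := by exact_mod_cast h.pos i
    have hT : (0 : ℤ) ≤ (n : ℤ) * L i := by positivity
    rw [abs_le] at hm
    -- Split off the part of `m` closest to `m` in `[-L_i, L_i]`.
    obtain ⟨k, hk, hk'⟩ : ∃ k : ℤ, |k| ≤ L i ∧ |m - k| ≤ (n : ℤ) * L i :=
      ⟨max (-L i) (min (L i) m), by rw [abs_le]; omega, by rw [abs_le]; omega⟩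
    rw [pow_succ, ← sub_add_cancel m k, zpow_add]
    exact Set.mul_mem_mul (ih _ hk') (h.zpow_mem i k hk)

theorem IsMonomial.mem_pow (h : ContainsPowers s x L P) {n m : ℕ} {ξ : GenComm r} {g : G}
    (hg : IsMonomial x (n • L) ξ m g) :
    g ∈ P ^ (4 ^ ξ.totalWeight * n) ∧ g⁻¹ ∈ P ^ (4 ^ ξ.totalWeight * n) := by
  induction hg with
  | letter i k hk =>
    have hk' : |(k : ℤ)| ≤ (n : ℤ) * L i := by
      rw [Nat.abs_cast]
      exact_mod_cast hk
    have hle : n ≤ 4 ^ (GenComm.letter i).totalWeight * n := by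
      rw [totalWeight_letter]; omega
    have h1 := h.zpow_mem_pow i n k hk'
    have h2 := h.zpow_mem_pow i n (-k) (by rwa [abs_neg])
    rw [zpow_natCast] at h1
    rw [zpow_neg, zpow_natCast] at h2
    exact ⟨h.pow_subset hle h1, h.pow_subset hle h2⟩
  | @comm ε δ ξ η m m' g g' _ _ ihg ihh =>
    have hsign : ∀ {k : ℕ} {g : G} (ε : ℤˣ), g ∈ P ^ k ∧ g⁻¹ ∈ P ^ k →
        g ^ (ε : ℤ) ∈ P ^ k ∧ (g ^ (ε : ℤ))⁻¹ ∈ P ^ k := by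
      intro k g ε hg
      rcases Int.units_eq_one_or ε with rfl | rfl
      · simpa using hg
      · simpa using hg.symm
    obtain ⟨h1, h2⟩ := hsign ε ihg
    obtain ⟨h3, h4⟩ := hsign δ ihh
    set a := 4 ^ ξ.totalWeight * n
    set b := 4 ^ η.totalWeight * n
    have hle : a + b + a + b ≤ 4 ^ (GenComm.comm ε ξ δ η).totalWeight * n := by
      rw [totalWeight_comm, pow_add]
      have e1 : 4 ≤ 4 ^ ξ.totalWeight :=
        Nat.le_self_pow (Nat.one_le_iff_ne_zero.1 (one_le_totalWeight ξ)) 4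
      have e2 : 4 ≤ 4 ^ η.totalWeight :=
        Nat.le_self_pow (Nat.one_le_iff_ne_zero.1 (one_le_totalWeight η)) 4
      calc a + b + a + b = (2 * 4 ^ ξ.totalWeight + 2 * 4 ^ η.totalWeight) * n := by ring
        _ ≤ _ := Nat.mul_le_mul_right _ (by nlinarith)
    refine ⟨h.pow_subset hle ?_, h.pow_subset hle ?_⟩
    · rw [pow_add, pow_add, pow_add]
      exact Set.mul_mem_mul (Set.mul_mem_mul (Set.mul_mem_mul h2 h4) h1) h3
    · have hperm : a + b + a + b = b + a + b + a := by ring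
      rw [hperm, pow_add, pow_add, pow_add]
      simp only [mul_inv_rev, inv_inv]
      rw [← mul_assoc, ← mul_assoc]
      exact Set.mul_mem_mul (Set.mul_mem_mul (Set.mul_mem_mul h4 h2) h3) h1

end

/-- `WordsShort.{u} r s d C` says that every word bounded by `n L` whose symbols have total weight
at least `d` is a product of `C n` elements of `P`, uniformly in `G`, `x`, `L`, `P` and `n`. -/
def WordsShort (r s d C : ℕ) : Prop :=
  ∀ {G : Type u} [Group G] (x : Fin r → G) (L : Fin r → ℕ) (P : Set G), ContainsPowers s x L P →
    ∀ (n : ℕ) (w : List (Symbol r)), Bounded (n • L) w → (∀ y ∈ w, d ≤ y.1.totalWeight) →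
      wordProd x w ∈ P ^ (C * n)

/-- A power `ξ ^ m` with `|m| ≤ (n L) ^ χ(ξ)` is a product of `O(n)` elements of `P`, if this is
known for words of higher weight. -/
theorem exists_zpow_mem_pow {s C : ℕ} (ξ : GenComm r)
    (hC : WordsShort.{u} r s (ξ.totalWeight + 1) C) :
    ∃ C' : ℕ, ∀ {G : Type u} [Group G] (x : Fin r → G) (L : Fin r → ℕ) (P : Set G),
      ContainsPowers s x L P → ∀ (n : ℕ) (m : ℤ), |m| ≤ (vecPow (n • L) ξ.weight : ℤ) →
        ξ.eval x ^ m ∈ P ^ (C' * n) := by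
  obtain ⟨c, hc⟩ := IsMonomial.exists_pow_mul.{u} ξ
  set B := 4 ^ ξ.totalWeight + C * c with hB
  refine ⟨ξ.totalWeight * B, fun {G} _ x L P h n m hm => ?_⟩
  have hξ : ξ.totalWeight ≠ 0 := Nat.one_le_iff_ne_zero.1 (one_le_totalWeight ξ)
  rcases Nat.eq_zero_or_pos n with rfl | hn
  · obtain rfl : m = 0 := by
      rw [vecPow_nsmul, zero_pow hξ, zero_mul] at hm
      simpa using hm
    simp
  -- The case of a single product of leaf exponents.
  have hone : ∀ k g, IsMonomial x (n • L) ξ k g →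
      ξ.eval x ^ k ∈ P ^ (B * n) ∧ (ξ.eval x ^ k)⁻¹ ∈ P ^ (B * n) := by
    intro k g hg
    obtain ⟨w, hw, hwt, hb⟩ := hc x (n • L) k g hg
    obtain ⟨h1, h2⟩ := hg.mem_pow h
    have h3 := hC x L P h (c * n) w (by rwa [mul_nsmul']) hwt
    have h4 := hC x L P h (c * n) (invWord w) (by rw [mul_nsmul']; exact hb.invWord)
      (fun y hy => by
        obtain ⟨z, hz, he⟩ := mem_invWord hy
        rw [← he]
        exact hwt z hz)
    rw [wordProd_invWord] at h4
    have he : ξ.eval x ^ k = g * (wordProd x w)⁻¹ := by rw [hw]; group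
    have hsum : B * n = 4 ^ ξ.totalWeight * n + C * (c * n) := by rw [hB]; ring
    constructor
    · rw [he, hsum, pow_add]
      exact Set.mul_mem_mul h1 h4
    · rw [he, hsum, add_comm, pow_add, mul_inv_rev, inv_inv]
      exact Set.mul_mem_mul h3 h2
  have hlist : ∀ ms : List ℕ, (∀ k ∈ ms, ∃ g, IsMonomial x (n • L) ξ k g) →
      ξ.eval x ^ ms.sum ∈ P ^ (ms.length * (B * n)) ∧
        (ξ.eval x ^ ms.sum)⁻¹ ∈ P ^ (ms.length * (B * n)) := by
    intro ms hms
    induction ms with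
    | nil => simp
    | cons k ms ih =>
      obtain ⟨g, hg⟩ := hms k (by simp)
      obtain ⟨h1, h2⟩ := hone k g hg
      obtain ⟨h3, h4⟩ := ih fun k hk => hms k (by simp [hk])
      rw [List.sum_cons, List.length_cons, add_mul, one_mul]
      refine ⟨?_, ?_⟩
      · rw [add_comm k, pow_add, pow_add]
        exact Set.mul_mem_mul h3 h1
      · rw [pow_add, pow_add, mul_inv_rev]
        exact Set.mul_mem_mul h4 h2
  obtain ⟨ms, hlen, hsum, hms⟩ := exists_sum_isMonomial x (N := n • L)
    (fun i => Nat.mul_pos hn (h.pos i)) ξ (m := m.natAbs) (by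
      rw [Int.abs_eq_natAbs] at hm
      exact_mod_cast hm)
  obtain ⟨h1, h2⟩ := hlist ms hms
  rw [hlen, hsum, ← mul_assoc] at h1 h2
  rcases Int.natAbs_eq m with hm' | hm'
  · rw [hm', zpow_natCast]
    exact h1
  · rw [hm', zpow_neg, zpow_natCast]
    exact h2

/-- If words of weight more than `d` are short, then so are words in which the symbols of weight
exactly `d` come from a given list `l`: extract these symbols one after the other. -/
theorem exists_wordProd_mem_pow_of_list {s d C : ℕ} (hC : WordsShort.{u} r s (d + 1) C)
    (l : List (GenComm r)) (hl : ∀ ξ ∈ l, ξ.totalWeight = d) :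
    ∀ c : ℕ, ∃ C' : ℕ, ∀ {G : Type u} [Group G] (x : Fin r → G) (L : Fin r → ℕ) (P : Set G),
      ContainsPowers s x L P → ∀ (n : ℕ) (w : List (Symbol r)), Bounded (c • n • L) w →
        (∀ y ∈ w, d ≤ y.1.totalWeight) → (∀ y ∈ w, y.1.totalWeight = d → y.1 ∈ l) →
        wordProd x w ∈ P ^ (C' * n) := by
  induction l with
  | nil =>
    refine fun c => ⟨C * c, fun x L P h n w hb hw hl => ?_⟩
    rw [mul_assoc]
    refine hC x L P h (c * n) w (by rwa [mul_nsmul']) fun y hy => ?_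
    have h1 := hw y hy
    have h2 := hl y hy
    by_contra hlt
    simpa using h2 (by omega)
  | cons ξ l ih =>
    intro c
    have hξ := hl ξ (by simp)
    obtain ⟨C₁, hC₁⟩ := exists_zpow_mem_pow ξ (hξ ▸ hC)
    obtain ⟨C₂, hC₂⟩ := ih (fun η hη => hl η (by simp [hη])) (2 * c)
    refine ⟨C₁ * c + C₂, fun x L P h n w hb hw hl' => ?_⟩
    obtain ⟨m, hm, he⟩ := exists_wordProd_occ x ξ w
    have h1 := hC₁ x L P h (c * n) m (hm.trans (by
      rw [mul_nsmul']
      exact_mod_cast hb ξ))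
    have h2 := hC₂ x L P h n (extract ξ w) (by rw [mul_nsmul']; exact hb.extract ξ)
      (fun y hy => by
        rcases mem_extract hw hy with h | h
        · exact hw y h.1
        · omega)
      (fun y hy hyd => by
        rcases mem_extract hw hy with h | h
        · exact (List.mem_cons.1 (hl' y h.1 hyd)).resolve_left h.2
        · have := one_le_totalWeight ξ
          omega)
    rw [wordProd_extract x ξ w, he, add_mul, pow_add, mul_assoc]
    exact Set.mul_mem_mul h1 h2

theorem exists_wordsShort (r s d : ℕ) : ∃ C : ℕ, WordsShort.{u} r s d C := by
  obtain ⟨k, hk⟩ : ∃ k, s + 1 ≤ d + k := ⟨s + 1, by omega⟩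
  induction k generalizing d with
  | zero =>
    refine ⟨0, fun x L P h n w _ hw => ?_⟩
    have : wordProd x w = 1 := by
      refine List.prod_eq_one fun g hg => ?_
      obtain ⟨y, hy, rfl⟩ := List.mem_map.1 hg
      have := hw y hy
      rw [val, h.eval_eq_one y.1 (by omega), one_zpow]
    simp [this]
  | succ k ih =>
    obtain ⟨C, hC⟩ := ih (d + 1) (by omega)
    obtain ⟨C', hC'⟩ := exists_wordProd_mem_pow_of_list hC
      ((upTo r d).filter fun ξ => ξ.totalWeight = d).toList (by simp) 1
    refine ⟨C', fun x L P h n w hb hw => hC' x L P h n w (by rwa [one_nsmul]) hw fun y hy hyd => ?_⟩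
    simp [upTo, hyd]

end Words

end GenComm

theorem containsPowers_nilcompleteProgression {G : Type*} [Group G] [Group.IsNilpotent G]
    {r s : ℕ} (hs : Group.nilpotencyClass G ≤ s) (ord : LinearOrder (GenComm r)) (x : Fin r → G)
    {L : Fin r → ℕ} (hL : ∀ i, 0 < L i) :
    GenComm.ContainsPowers s x L (nilcompleteProgression ord s x L) := by
  classical
  have htriv : ∀ ζ : GenComm r, s < ζ.totalWeight → ζ.eval x = 1 := fun ζ hζ =>
    GenComm.eval_eq_one_of_nilpotencyClass_lt x (hs.trans_lt hζ)
  refine ⟨htriv, hL, one_mem_nilcompleteProgression ord x L, fun i m hm => ?_⟩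
  have hnd := GenComm.nodup_orderedList ord s
  refine ⟨fun ζ => if ζ = GenComm.letter i then m else 0, fun ξ _ => ?_, ?_⟩
  · by_cases h : ξ = GenComm.letter i
    · subst h
      simpa [vecPow_letter] using hm
    · simp [h]
  · by_cases hmem : GenComm.letter i ∈ GenComm.orderedList ord s
    · rw [List.prod_map_eq_pow_single (GenComm.letter i)]
      · rw [List.count_eq_one_of_mem hnd hmem]
        simp [GenComm.eval]
      · intro ζ hζ _
        simp [hζ]
    · have h1 : x i = 1 := htriv (.letter i) (by
        rw [GenComm.mem_orderedList] at hmem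
        omega)
      rw [h1, one_zpow, eq_comm]
      refine List.prod_eq_one fun g hg => ?_
      obtain ⟨ζ, hζ, rfl⟩ := List.mem_map.1 hg
      have : ζ ≠ GenComm.letter i := by
        rintro rfl
        exact hmem hζ
      simp [this]

theorem exists_nilcompleteProgression_subset_pow (r s : ℕ) :
    ∃ C : ℕ, ∀ (G : Type*) [Group G] [Group.IsNilpotent G], Group.nilpotencyClass G ≤ s →
      ∀ (ord : LinearOrder (GenComm r)), GenComm.IsAdmissible ord →
      ∀ (x : Fin r → G) (L : Fin r → ℕ), (∀ i, 0 < L i) → ∀ n : ℕ,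
        nilcompleteProgression ord s x (n • L) ⊆ nilcompleteProgression ord s x L ^ (C * n) := by
  obtain ⟨C, hC⟩ := GenComm.exists_wordsShort r s 0
  refine ⟨C, fun G _ _ hG ord _ x L hL n => ?_⟩
  rintro _ ⟨a, ha, rfl⟩
  have h := hC x L _ (containsPowers_nilcompleteProgression hG ord x hL) n
    (GenComm.listWord a (GenComm.orderedList ord s))
    (GenComm.bounded_listWord (GenComm.nodup_orderedList ord s) ha) (by simp)
  rwa [GenComm.wordProd_listWord] at h

/-! ### Powers of nilcomplete progressions -/

theorem mainTheorem5 (r s : ℕ) :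
    (∃ C : ℕ, ∀ (G : Type*) [Group G] [Group.IsNilpotent G], Group.nilpotencyClass G ≤ s →
      ∀ (ord : LinearOrder (GenComm r)), GenComm.IsAdmissible ord →
      ∀ (x : Fin r → G) (L : Fin r → ℕ), (∀ i, 0 < L i) → ∀ n : ℕ,
        nilcompleteProgression ord s x (n • L) ⊆ nilcompleteProgression ord s x L ^ (C * n)) ∧
    (∀ (G : Type*) [Group G] [Group.IsNilpotent G], Group.nilpotencyClass G ≤ s →
      ∀ (ord : LinearOrder (GenComm r)), GenComm.IsAdmissible ord →
      ∀ (x : Fin r → G) (L : Fin r → ℕ), (∀ i, 0 < L i) → ∀ n : ℕ,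
        nilcompleteProgression ord s x L ^ n ⊆ nilcompleteProgression ord s x (n • L)) ∧
    (∀ M : ℕ, ∃ K : ℕ, ∀ (G : Type*) [Group G] [Group.IsNilpotent G],
      Group.nilpotencyClass G ≤ s →
      ∀ (ord : LinearOrder (GenComm r)), GenComm.IsAdmissible ord →
      ∀ (x : Fin r → G) (L : Fin r → ℕ), (∀ i, 0 < L i) →
        ∃ X : Finset G, X.card ≤ K ∧
          nilcompleteProgression ord s x (M • L) ⊆
            nilcompleteProgression ord s x L * (X : Set G)) := by
  exact ⟨exists_nilcompleteProgression_subset_pow r s,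
    fun _ _ _ hG ord hord x L _ n => nilcompleteProgression_pow_subset hG hord x L n,
    exists_nilcompleteProgression_nsmul_subset r s⟩
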